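/- **Theorem.** In the online preemptive maximum weight matching problem, the edges of a finite simple graph with positive weights are revealed one by one, and an algorithm maintains a matching, initially empty. On the arrival of each edge, with its weight, the algorithm irrevocably accepts or rejects it: if the edge is accepted, it is added to the current matching and all edges of the current matching sharing an endpoint with it (the conflicting edges) are discarded; if it is rejected, the matching is unchanged. A randomized algorithm is described by the conditional probability with which it accepts the new edge, given the edges revealed so far and the decisions taken so far. It is called a *randomized local algorithm* if this conditional probability is a function only of the weight of the new edge and of the (unordered collection of) weights of the conflicting edges in the current matching; in particular, given the current matching, the acceptance of a new edge is independent of all earlier coin tosses. An algorithm has *competitive ratio* $c>0$ if, for every finite simple graph with positive edge weights and every order of revealing its edges, the expected weight of the matching held at the end is at least $\frac1c$ times the maximum weight of a matching in the graph. If a randomized local algorithm has competitive ratio $c$, then $c\ge 3+2\sqrt2$. That is, no randomized local algorithm for maximum weight matching has a competitive ratio less than $3+2\sqrt2$. -/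

import Mathlib

noncomputable section

/-- A weighted edge, given by its unordered pair of endpoints and its weight. Vertices are named by
natural numbers, so that every finite weighted graph can be presented. -/
@[ext] structure WEdge where
  ends : Sym2 ℕ
  weight : ℝ

/-- Two edges conflict if they have a common endpoint. -/
def WEdge.Conflicts (e g : WEdge) : Prop := ∃ v, v ∈ e.ends ∧ v ∈ g.ends

/-- The edges in the list form a finite simple graph with positive edge weights: no loops, no
edge presented twice. -/
def IsInstance (σ : List WEdge) : Prop :=
  (∀ e ∈ σ, ¬ e.ends.IsDiag ∧ 0 < e.weight) ∧ (σ.map WEdge.ends).Nodup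

/-- A set of edges no two of which share an endpoint. -/
def IsMatching (M : Finset WEdge) : Prop :=
  (M : Set WEdge).Pairwise fun e g => ¬ e.Conflicts g

/-- The total weight of a set of edges. -/
def totalWeight (M : Finset WEdge) : ℝ := ∑ e ∈ M, e.weight

open scoped Classical in
/-- The offline optimum: the maximum weight of a matching in the graph with edge list `σ`. -/
def optWeight (σ : List WEdge) : ℝ :=
  (σ.toFinset.powerset.filter IsMatching).sup' ⟨∅, by simp [IsMatching]⟩ totalWeight

/-- What has happened so far: the revealed edges, the most recent one first, each with the
decision taken on its arrival (`true` if it was accepted). -/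
abbrev Transcript : Type := List (WEdge × Bool)

open scoped Classical in
/-- The matching held after a transcript: an accepted edge is added and the edges of the matching
that conflict with it are discarded; a rejected edge changes nothing. -/
def currentMatching : Transcript → Finset WEdge
  | [] => ∅
  | (e, true) :: h => insert e ((currentMatching h).filter fun g => ¬ e.Conflicts g)
  | (_, false) :: h => currentMatching h

open scoped Classical in
/-- The multiset of the weights of the edges of the current matching that conflict with `e`. -/
def conflictWeights (h : Transcript) (e : WEdge) : Multiset ℝ :=
  ((currentMatching h).filter fun g => e.Conflicts g).val.map WEdge.weight

/-- A randomized online preemptive algorithm, given by the conditional probability with which it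
accepts the newly revealed edge, given everything that was revealed and decided before. -/
structure OnlineAlgorithm where
  acceptProb : Transcript → WEdge → unitInterval

/-- A coin that shows `true` with probability `p` and `false` with probability `1 - p`. -/
def coin (p : unitInterval) : PMF Bool :=
  PMF.ofFintype (fun b => cond b (ENNReal.ofReal p) (ENNReal.ofReal (1 - p))) (by
    rw [Fintype.sum_bool]
    simp only [cond_true, cond_false]
    rw [← ENNReal.ofReal_add p.2.1 (sub_nonneg.2 p.2.2)]
    simp)

namespace OnlineAlgorithm

/-- The algorithm is local: the conditional probability of accepting a new edge, given all of the
past, is a function of the weights of the conflicting edges of the current matching and of the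
weight of the new edge only. -/
def IsLocal (A : OnlineAlgorithm) : Prop :=
  ∃ f : Multiset ℝ → ℝ → unitInterval,
    ∀ (h : Transcript) (e : WEdge), IsInstance (e :: h.map Prod.fst) →
      A.acceptProb h e = f (conflictWeights h e) e.weight

/-- The law of the transcript after the edges of the list have been revealed one by one (the head
of the list first), starting from a given transcript. -/
def runFrom (A : OnlineAlgorithm) : Transcript → List WEdge → PMF Transcript
  | h, [] => PMF.pure h
  | h, e :: σ =>
      (coin (A.acceptProb h e)).bind fun b => A.runFrom ((e, b) :: h) σ

/-- The expected weight of the matching held after all edges of `σ` have been revealed. The law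
of the transcript has finite support, so the sum is a finite one. -/
def expectedWeight (A : OnlineAlgorithm) (σ : List WEdge) : ℝ :=
  ∑' h : Transcript, (A.runFrom [] σ h).toReal * totalWeight (currentMatching h)

/-- The algorithm has competitive ratio `c`: on all inputs, the expected weight of its matching is
at least `1 / c` times the offline optimum. -/
def IsCompetitive (A : OnlineAlgorithm) (c : ℝ) : Prop :=
  0 < c ∧ ∀ σ : List WEdge, IsInstance σ → 1 / c * optWeight σ ≤ A.expectedWeight σ

end OnlineAlgorithm

end

/-! Locality means that the algorithm is one function `f` of the conflicting weights and the new
weight, and that its future depends on the past only through the current matching. The adversary is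
oblivious, but it knows `f` and can amplify any positive acceptance probability by repetition.

Three facts about a competitive `f` follow. An isolated edge is accepted with positive probability.
If `f {x} z > 0`, then `x ≤ c * z`: a long star of `z`-edges would otherwise displace the `x`-edge
almost surely. Finally `f {y, a} y = 0` (`accept_pair_eq_zero`): a hub vertex holding a `y`-edge
could otherwise wear down any number of disjoint `a`-edges, while keeping only one edge for itself.

Suppose now that the algorithm holds about `n` edges of weight `x` between two sets `U` and `V` of
size `n`, and that the graph contains a matching of weight `r * n` avoiding both. If `f {x} z = 0`,
pendant edges of weight `z` at `U` and `V` are essentially all rejected, so `r + 2 * z ≤ c * x`.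
Alternatively, pendants are attached to `U` only, and `V` is joined to `n` new vertices `W` by edges
of a weight `y` with `f {x} y > 0`. By the third fact no accepted edge displaces two edges, so the
number of new edges held never drops; suitably chosen pairs push it close to `n` in expectation
(`StageSetup.exists_pairList`). The old situation is reproduced with `V`, `W`, `y`, `r + z` in place
of `U`, `V`, `x`, `r` (`Prepared.extend`).

With `y` just above and `z` just below the supremum of the rejected weights, `z` and `y` almost
agree. Up to this small loss, `ρ = r / x` becomes `ρ * (x / y) + 1`, while `2 * y / x ≤ c - ρ`. For
`c < 3 + 2 * √2` the map `ρ ↦ 2 * ρ / (c - ρ) + 1` has no fixed point on `0 ≤ ρ < c`, and `ρ` grows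
by a fixed amount at each round (`ratio_step`), although it must stay below `c`. -/

noncomputable section

/-! ### Expectations and reachable matchings under a local rule -/

open scoped Classical in
/-- The weights of the edges of `M` that conflict with `e`. -/
def conflictW (M : Finset WEdge) (e : WEdge) : Multiset ℝ :=
  (M.filter fun g => e.Conflicts g).val.map WEdge.weight

open scoped Classical in
/-- The matching after `e` has been accepted. -/
def acceptEdge (M : Finset WEdge) (e : WEdge) : Finset WEdge :=
  insert e (M.filter fun g => ¬ e.Conflicts g)

/-- The expected value of `g` at the final matching, when the edges of the list arrive at a local
algorithm with acceptance probabilities `f` that currently holds `M`. -/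
def expect (f : Multiset ℝ → ℝ → unitInterval) :
    Finset WEdge → List WEdge → (Finset WEdge → ℝ) → ℝ
  | M, [], g => g M
  | M, e :: σ, g =>
      (f (conflictW M e) e.weight : ℝ) * expect f (acceptEdge M e) σ g +
        (1 - (f (conflictW M e) e.weight : ℝ)) * expect f M σ g

/-- The matching `M'` can be reached with positive probability from `M`. -/
def Reach (f : Multiset ℝ → ℝ → unitInterval) :
    Finset WEdge → List WEdge → Finset WEdge → Prop
  | M, [], M' => M' = M
  | M, e :: σ, M' =>
      (0 < (f (conflictW M e) e.weight : ℝ) ∧ Reach f (acceptEdge M e) σ M') ∨ Reach f M σ M'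

section Expectation

variable {f : Multiset ℝ → ℝ → unitInterval}

/-- Comparing only on reachable matchings is what makes structure available later: branches of
probability zero are pruned, so vanishing values of `f` become facts about every matching
considered. -/
theorem expect_mono {M : Finset WEdge} {σ : List WEdge} {g g' : Finset WEdge → ℝ}
    (h : ∀ M', Reach f M σ M' → g M' ≤ g' M') : expect f M σ g ≤ expect f M σ g' := by
  induction σ generalizing M with
  | nil => exact h M rfl
  | cons e σ ih =>
    simp only [expect]
    have h0 := (f (conflictW M e) e.weight).2.1
    have h1 := (f (conflictW M e) e.weight).2.2
    refine add_le_add ?_ (mul_le_mul_of_nonneg_left (ih fun M' hM' => h M' (Or.inr hM'))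
      (by linarith))
    rcases h0.eq_or_lt with h0 | h0
    · rw [← h0]; simp
    · exact mul_le_mul_of_nonneg_left (ih fun M' hM' => h M' (Or.inl ⟨h0, hM'⟩)) h0.le

theorem expect_congr {M : Finset WEdge} {σ : List WEdge} {g g' : Finset WEdge → ℝ}
    (h : ∀ M', Reach f M σ M' → g M' = g' M') : expect f M σ g = expect f M σ g' :=
  le_antisymm (expect_mono fun M' hM' => (h M' hM').le)
    (expect_mono fun M' hM' => (h M' hM').ge)

theorem expect_const (M : Finset WEdge) (σ : List WEdge) (a : ℝ) :
    expect f M σ (fun _ => a) = a := by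
  induction σ generalizing M with
  | nil => rfl
  | cons e σ ih => simp only [expect, ih]; ring

theorem expect_add (M : Finset WEdge) (σ : List WEdge) (g g' : Finset WEdge → ℝ) :
    expect f M σ (fun M => g M + g' M) = expect f M σ g + expect f M σ g' := by
  induction σ generalizing M with
  | nil => rfl
  | cons e σ ih => simp only [expect, ih]; ring

theorem expect_const_mul (M : Finset WEdge) (σ : List WEdge) (a : ℝ) (g : Finset WEdge → ℝ) :
    expect f M σ (fun M => a * g M) = a * expect f M σ g := by
  induction σ generalizing M with
  | nil => rfl
  | cons e σ ih => simp only [expect, ih]; ring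

theorem expect_sub (M : Finset WEdge) (σ : List WEdge) (g g' : Finset WEdge → ℝ) :
    expect f M σ (fun M => g M - g' M) = expect f M σ g - expect f M σ g' := by
  induction σ generalizing M with
  | nil => rfl
  | cons e σ ih => simp only [expect, ih]; ring

theorem expect_sum {ι : Type*} (s : Finset ι) (M : Finset WEdge) (σ : List WEdge)
    (g : ι → Finset WEdge → ℝ) :
    expect f M σ (fun M => ∑ i ∈ s, g i M) = ∑ i ∈ s, expect f M σ (g i) := by
  classical
  induction s using Finset.induction_on with
  | empty => simpa using expect_const M σ 0
  | insert a s ha ih => simp only [Finset.sum_insert ha, expect_add, ih]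

theorem expect_append (M : Finset WEdge) (σ τ : List WEdge) (g : Finset WEdge → ℝ) :
    expect f M (σ ++ τ) g = expect f M σ (fun M' => expect f M' τ g) := by
  induction σ generalizing M with
  | nil => rfl
  | cons e σ ih => simp only [List.cons_append, expect, ih]

theorem reach_append {M M' : Finset WEdge} {σ τ : List WEdge} :
    Reach f M (σ ++ τ) M' ↔ ∃ M₁, Reach f M σ M₁ ∧ Reach f M₁ τ M' := by
  induction σ generalizing M with
  | nil => simp [Reach]
  | cons e σ ih =>
    simp only [List.cons_append, Reach, ih]
    constructor
    · rintro (⟨h, M₁, h1, h2⟩ | ⟨M₁, h1, h2⟩)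
      · exact ⟨M₁, Or.inl ⟨h, h1⟩, h2⟩
      · exact ⟨M₁, Or.inr h1, h2⟩
    · rintro ⟨M₁, ⟨h, h1⟩ | h1, h2⟩
      · exact Or.inl ⟨h, M₁, h1, h2⟩
      · exact Or.inr ⟨M₁, h1, h2⟩

theorem WEdge.Conflicts.symm {e g : WEdge} (h : e.Conflicts g) : g.Conflicts e := by
  obtain ⟨v, h1, h2⟩ := h
  exact ⟨v, h2, h1⟩

theorem mem_acceptEdge {M : Finset WEdge} {e g : WEdge} :
    g ∈ acceptEdge M e ↔ g = e ∨ (g ∈ M ∧ ¬ e.Conflicts g) := by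
  simp [acceptEdge]

theorem isMatching_acceptEdge {M : Finset WEdge} (hM : IsMatching M) (e : WEdge) :
    IsMatching (acceptEdge M e) := by
  intro a ha b hb hab
  rw [Finset.mem_coe, mem_acceptEdge] at ha hb
  rcases ha with rfl | ⟨ha, ha'⟩
  · rcases hb with rfl | ⟨hb, hb'⟩
    · exact absurd rfl hab
    · exact hb'
  · rcases hb with rfl | ⟨hb, hb'⟩
    · exact fun h => ha' h.symm
    · exact hM ha hb hab

theorem Reach.isMatching {M M' : Finset WEdge} {σ : List WEdge} (h : Reach f M σ M')
    (hM : IsMatching M) : IsMatching M' := by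
  induction σ generalizing M with
  | nil => rw [show M' = M from h]; exact hM
  | cons e σ ih =>
    rcases h with ⟨_, h⟩ | h
    · exact ih h (isMatching_acceptEdge hM e)
    · exact ih h hM

theorem Reach.subset {M M' : Finset WEdge} {σ : List WEdge} (h : Reach f M σ M') :
    ∀ g ∈ M', g ∈ M ∨ g ∈ σ := by
  induction σ generalizing M with
  | nil => rw [show M' = M from h]; exact fun g hg => Or.inl hg
  | cons e σ ih =>
    intro g hg
    rcases h with ⟨_, h⟩ | h
    · rcases ih h g hg with h1 | h1
      · rcases mem_acceptEdge.1 h1 with rfl | h1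
        · simp
        · exact Or.inl h1.1
      · simp [h1]
    · rcases ih h g hg with h1 | h1 <;> simp [h1]

theorem isMatching_empty : IsMatching ∅ := by simp [IsMatching]

theorem Reach.mem {M' : Finset WEdge} {σ : List WEdge} (h : Reach f ∅ σ M') {g : WEdge}
    (hg : g ∈ M') : g ∈ σ := by
  simpa using h.subset g hg

/-- The effect of one more edge. -/
theorem expect_concat (M : Finset WEdge) (σ : List WEdge) (e : WEdge) (g : Finset WEdge → ℝ) :
    expect f M (σ ++ [e]) g = expect f M σ (fun M =>
      g M + (f (conflictW M e) e.weight : ℝ) * (g (acceptEdge M e) - g M)) := by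
  rw [expect_append]
  congr 1
  funext M
  simp only [expect]
  ring

end Expectation

/-! ### From laws of transcripts to expectations over matchings -/

section Reduction

theorem IsInstance.perm {σ τ : List WEdge} (h : IsInstance σ) (p : σ.Perm τ) : IsInstance τ :=
  ⟨fun e he => h.1 e (p.mem_iff.2 he), (p.map WEdge.ends).nodup_iff.1 h.2⟩

theorem IsInstance.append_left {σ τ : List WEdge} (h : IsInstance (σ ++ τ)) : IsInstance σ := by
  refine ⟨fun e he => h.1 e (by simp [he]), ?_⟩
  have := h.2
  rw [List.map_append] at this
  exact this.of_append_left

theorem finite_support_runFrom (A : OnlineAlgorithm) (h : Transcript) (σ : List WEdge) :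
    (A.runFrom h σ).support.Finite := by
  induction σ generalizing h with
  | nil => simp [OnlineAlgorithm.runFrom]
  | cons e σ ih =>
    rw [OnlineAlgorithm.runFrom, PMF.support_bind]
    exact Set.Finite.biUnion (Set.toFinite _) fun b _ => ih _

/-- Conditioning on the first coin matches the recursion of `expect`. The instance hypothesis is
carried along because locality is only granted on transcripts that form valid inputs. -/
theorem tsum_runFrom {A : OnlineAlgorithm} {f : Multiset ℝ → ℝ → unitInterval}
    (hf : ∀ (h : Transcript) (e : WEdge), IsInstance (e :: h.map Prod.fst) →
      A.acceptProb h e = f (conflictWeights h e) e.weight)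
    (g : Finset WEdge → ℝ) (σ : List WEdge) (h : Transcript)
    (hσ : IsInstance (h.map Prod.fst ++ σ)) :
    ∑' t : Transcript, (A.runFrom h σ t).toReal * g (currentMatching t) =
      expect f (currentMatching h) σ g := by
  induction σ generalizing h with
  | nil =>
    rw [tsum_eq_single h]
    · simp [OnlineAlgorithm.runFrom, expect]
    · intro t ht
      simp [OnlineAlgorithm.runFrom, ht]
  | cons e σ ih =>
    have hp : IsInstance ((e :: h.map Prod.fst) ++ σ) :=
      hσ.perm (by simp)
    have he := hf h e hp.append_left
    have hs : ∀ b : Bool, Summable fun t : Transcript =>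
        (A.runFrom ((e, b) :: h) σ t).toReal * g (currentMatching t) := fun b =>
      summable_of_hasFiniteSupport ((finite_support_runFrom A ((e, b) :: h) σ).subset (by
        intro t ht
        rw [Function.mem_support] at ht
        rw [PMF.mem_support_iff]
        intro h0
        simp [h0] at ht))
    have hstep : ∀ t : Transcript, (A.runFrom h (e :: σ) t).toReal * g (currentMatching t) =
        (A.acceptProb h e : ℝ) *
          ((A.runFrom ((e, true) :: h) σ t).toReal * g (currentMatching t)) +
        (1 - (A.acceptProb h e : ℝ)) *
          ((A.runFrom ((e, false) :: h) σ t).toReal * g (currentMatching t)) := by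
      intro t
      rw [OnlineAlgorithm.runFrom, PMF.bind_apply, tsum_bool]
      have h1 : coin (A.acceptProb h e) true = ENNReal.ofReal (A.acceptProb h e) := rfl
      have h2 : coin (A.acceptProb h e) false = ENNReal.ofReal (1 - A.acceptProb h e) := rfl
      rw [h1, h2, ENNReal.toReal_add, ENNReal.toReal_mul, ENNReal.toReal_mul,
        ENNReal.toReal_ofReal (A.acceptProb h e).2.1,
        ENNReal.toReal_ofReal (sub_nonneg.2 (A.acceptProb h e).2.2)]
      · ring
      · exact ENNReal.mul_ne_top ENNReal.ofReal_ne_top (PMF.apply_ne_top _ _)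
      · exact ENNReal.mul_ne_top ENNReal.ofReal_ne_top (PMF.apply_ne_top _ _)
    simp_rw [hstep]
    rw [((hs true).mul_left _).tsum_add ((hs false).mul_left _), tsum_mul_left, tsum_mul_left,
      ih ((e, true) :: h) hp, ih ((e, false) :: h) hp, he]
    rfl

/-- A local acceptance rule whose expected weight is at least `1 / c` times any matching of the
input. -/
def LocalCompetitive (f : Multiset ℝ → ℝ → unitInterval) (c : ℝ) : Prop :=
  0 < c ∧ ∀ σ : List WEdge, IsInstance σ → ∀ N : Finset WEdge, (∀ e ∈ N, e ∈ σ) → IsMatching N →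
    totalWeight N ≤ c * expect f ∅ σ totalWeight

theorem exists_localCompetitive {A : OnlineAlgorithm} (hA : A.IsLocal) {c : ℝ}
    (hc : A.IsCompetitive c) : ∃ f, LocalCompetitive f c := by
  classical
  obtain ⟨f, hf⟩ := hA
  refine ⟨f, hc.1, fun σ hσ N hN hN' => ?_⟩
  have h1 := hc.2 σ hσ
  have h2 : A.expectedWeight σ = expect f ∅ σ totalWeight :=
    tsum_runFrom hf totalWeight σ [] (by simpa using hσ)
  have h3 : totalWeight N ≤ optWeight σ := by
    unfold optWeight
    refine Finset.le_sup' totalWeight ?_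
    simp only [Finset.mem_filter, Finset.mem_powerset]
    exact ⟨fun e he => by simpa using hN e he, hN'⟩
  rw [h2, one_div, inv_mul_le_iff₀ hc.1] at h1
  exact h3.trans h1

end Reduction

/-! ### Edges, conflicts and the weights seen at a vertex -/

section Incidence

/-- The edge with endpoints `u` and `v` and weight `x`. -/
def mkEdge (u v : ℕ) (x : ℝ) : WEdge := ⟨s(u, v), x⟩

@[simp] theorem mem_ends_mkEdge {u v t : ℕ} {x : ℝ} : t ∈ (mkEdge u v x).ends ↔ t = u ∨ t = v :=
  Sym2.mem_iff

@[simp] theorem weight_mkEdge {u v : ℕ} {x : ℝ} : (mkEdge u v x).weight = x := rfl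

theorem mkEdge_conflicts {u v : ℕ} {x : ℝ} {g : WEdge} :
    (mkEdge u v x).Conflicts g ↔ u ∈ g.ends ∨ v ∈ g.ends := by
  constructor
  · rintro ⟨t, ht, htg⟩
    rcases mem_ends_mkEdge.1 ht with rfl | rfl
    · exact Or.inl htg
    · exact Or.inr htg
  · rintro (h | h)
    · exact ⟨u, by simp, h⟩
    · exact ⟨v, by simp, h⟩

theorem WEdge.conflicts_self (e : WEdge) : e.Conflicts e :=
  ⟨e.ends.out.1, Sym2.out_fst_mem _, Sym2.out_fst_mem _⟩

open scoped Classical in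
/-- The weights of the edges of `M` at the vertex `v`. -/
def weightsAt (M : Finset WEdge) (v : ℕ) : Multiset ℝ :=
  (M.filter fun g => v ∈ g.ends).val.map WEdge.weight

theorem IsMatching.eq_of_mem {M : Finset WEdge} (hM : IsMatching M) {g g' : WEdge} (hg : g ∈ M)
    (hg' : g' ∈ M) {v : ℕ} (hv : v ∈ g.ends) (hv' : v ∈ g'.ends) : g = g' := by
  by_contra h
  exact hM hg hg' h ⟨v, hv, hv'⟩

theorem weightsAt_eq_zero {M : Finset WEdge} {v : ℕ} :
    weightsAt M v = 0 ↔ ∀ g ∈ M, v ∉ g.ends := by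
  simp [weightsAt]

theorem IsMatching.weightsAt_eq {M : Finset WEdge} (hM : IsMatching M) {g : WEdge} (hg : g ∈ M)
    {v : ℕ} (hv : v ∈ g.ends) : weightsAt M v = {g.weight} := by
  classical
  have : M.filter (fun g => v ∈ g.ends) = {g} := by
    ext g'
    simp only [Finset.mem_filter, Finset.mem_singleton]
    exact ⟨fun h => hM.eq_of_mem h.1 hg h.2 hv, by rintro rfl; exact ⟨hg, hv⟩⟩
  unfold weightsAt
  convert congrArg (fun s : Finset WEdge => s.val.map WEdge.weight) this using 3
  simp

theorem weightsAt_congr {M M' : Finset WEdge} {v : ℕ}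
    (h : ∀ g, v ∈ g.ends → (g ∈ M ↔ g ∈ M')) : weightsAt M v = weightsAt M' v := by
  classical
  unfold weightsAt
  congr 2
  ext g
  simp only [Finset.mem_filter]
  exact ⟨fun hg => ⟨(h g hg.2).1 hg.1, hg.2⟩, fun hg => ⟨(h g hg.2).2 hg.1, hg.2⟩⟩

theorem conflictW_of_free_right {M : Finset WEdge} {u v : ℕ} {x : ℝ}
    (h : ∀ g ∈ M, v ∉ g.ends) : conflictW M (mkEdge u v x) = weightsAt M u := by
  classical
  unfold conflictW weightsAt
  congr 2
  ext g
  simp only [Finset.mem_filter, mkEdge_conflicts]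
  exact ⟨fun hg => ⟨hg.1, hg.2.resolve_right (h g hg.1)⟩, fun hg => ⟨hg.1, Or.inl hg.2⟩⟩

theorem mkEdge_comm (u v : ℕ) (x : ℝ) : mkEdge u v x = mkEdge v u x := by
  simp [mkEdge, Sym2.eq_swap]

theorem conflictW_pair {M : Finset WEdge} (hM : IsMatching M) {u v : ℕ} {x : ℝ} {g g' : WEdge}
    (hg : g ∈ M) (hg' : g' ∈ M) (hu : u ∈ g.ends) (hv : v ∈ g'.ends) (hne : g ≠ g') :
    conflictW M (mkEdge u v x) = {g.weight, g'.weight} := by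
  classical
  have : M.filter (fun h => (mkEdge u v x).Conflicts h) = {g, g'} := by
    ext h
    simp only [Finset.mem_filter, Finset.mem_insert, Finset.mem_singleton, mkEdge_conflicts]
    constructor
    · rintro ⟨hh, h1 | h1⟩
      · exact Or.inl (hM.eq_of_mem hh hg h1 hu)
      · exact Or.inr (hM.eq_of_mem hh hg' h1 hv)
    · rintro (rfl | rfl)
      · exact ⟨hg, Or.inl hu⟩
      · exact ⟨hg', Or.inr hv⟩
  have h2 : ({g, g'} : Finset WEdge).val = {g, g'} := by
    rw [Finset.insert_val_of_notMem (by simpa using hne)]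
    rfl
  unfold conflictW
  convert congrArg (fun s : Finset WEdge => s.val.map WEdge.weight) this using 3
  rw [h2]
  simp

theorem sum_acceptEdge (M : Finset WEdge) (e : WEdge) (g : WEdge → ℝ)
    [DecidablePred fun h => ¬ e.Conflicts h] :
    ∑ h ∈ acceptEdge M e, g h = g e + ∑ h ∈ M.filter (fun h => ¬ e.Conflicts h), g h := by
  classical
  unfold acceptEdge
  rw [Finset.sum_insert]
  · congr 2
    ext; simp
  · simp [e.conflicts_self]

theorem isInstance_append {σ τ : List WEdge} (hσ : IsInstance σ) (hτ : IsInstance τ)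
    (h : ∀ e ∈ τ, ∀ g ∈ σ, e.ends ≠ g.ends) : IsInstance (σ ++ τ) := by
  refine ⟨fun e he => ?_, ?_⟩
  · rcases List.mem_append.1 he with he | he
    · exact hσ.1 e he
    · exact hτ.1 e he
  · rw [List.map_append, List.nodup_append]
    refine ⟨hσ.2, hτ.2, ?_⟩
    intro a ha b hb hab
    obtain ⟨g, hg, rfl⟩ := List.mem_map.1 ha
    obtain ⟨e, he, rfl⟩ := List.mem_map.1 hb
    exact h e he g hg hab.symm

theorem exists_vertex_bound (σ : List WEdge) : ∃ B : ℕ, ∀ g ∈ σ, ∀ v ∈ g.ends, v < B := by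
  induction σ with
  | nil => exact ⟨0, by simp⟩
  | cons e σ ih =>
    obtain ⟨B, hB⟩ := ih
    obtain ⟨ends, w⟩ := e
    induction ends using Sym2.ind with
    | _ a b =>
      refine ⟨B + a + b + 1, fun g hg v hv => ?_⟩
      rcases List.mem_cons.1 hg with rfl | hg
      · rcases Sym2.mem_iff.1 hv with rfl | rfl <;> omega
      · have := hB g hg v hv
        omega

theorem isInstance_nil : IsInstance [] := ⟨by simp, by simp⟩

theorem isInstance_singleton {u v : ℕ} (h : u ≠ v) {x : ℝ} (hx : 0 < x) :
    IsInstance [mkEdge u v x] := by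
  refine ⟨fun e he => ?_, by simp⟩
  rw [List.mem_singleton] at he
  subst he
  exact ⟨by simpa [mkEdge] using h, hx⟩

/-- The star with center `b`. -/
theorem isInstance_star {b : ℕ} {l : List ℕ} (hl : l.Nodup) (hb : b ∉ l) {x : ℝ} (hx : 0 < x) :
    IsInstance (l.map fun v => mkEdge b v x) := by
  refine ⟨fun e he => ?_, ?_⟩
  · obtain ⟨v, hv, rfl⟩ := List.mem_map.1 he
    refine ⟨?_, hx⟩
    simp only [mkEdge, Sym2.mk_isDiag_iff]
    rintro rfl
    exact hb hv
  · rw [List.map_map]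
    refine hl.map_on ?_
    intro u hu v hv huv
    simp only [Function.comp, mkEdge, Sym2.eq_iff] at huv
    rcases huv with h | h
    · exact h.2
    · exact h.2.trans h.1

end Incidence

/-! ### What a single edge forces on the acceptance rule -/

section SingleEdge

variable {f : Multiset ℝ → ℝ → unitInterval} {c : ℝ}

theorem isMatching_singleton (e : WEdge) : IsMatching {e} := by simp [IsMatching]

@[simp] theorem totalWeight_singleton (e : WEdge) : totalWeight {e} = e.weight := by
  simp [totalWeight]

theorem LocalCompetitive.accept_free_pos (hf : LocalCompetitive f c) {x : ℝ} (hx : 0 < x) :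
    0 < (f 0 x : ℝ) := by
  have h := hf.2 [mkEdge 0 1 x] (isInstance_singleton (by norm_num) hx) {mkEdge 0 1 x} (by simp)
    (isMatching_singleton _)
  rcases (f 0 x).2.1.eq_or_lt with h0 | h0
  · have h1 : conflictW ∅ (mkEdge 0 1 x) = 0 := by simp [conflictW]
    simp only [expect, h1, weight_mkEdge, totalWeight_singleton] at h
    rw [← h0] at h
    simp [totalWeight] at h
    linarith
  · exact h0

/-- An edge is not given up for edges of much smaller weight. -/
theorem LocalCompetitive.le_of_accept (hf : LocalCompetitive f c) {x z : ℝ} (hx : 0 < x)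
    (hz : 0 < z) (h : 0 < (f {x} z : ℝ)) : x ≤ c * z := by
  classical
  set p : ℝ := ((f {x} z : unitInterval) : ℝ) with hp
  have hp1 : p ≤ 1 := (f {x} z).2.2
  set e := mkEdge 0 1 x with he
  -- The `z`-edges all meet the endpoint `0` of `e` and have fresh leaves. While `e` is held it is
  -- the only conflict, so each of them removes `e` with probability exactly `p`.
  let τ : ℕ → List WEdge := fun n => ((List.range n).map (· + 2)).map fun v => mkEdge 0 v z
  let σ : ℕ → List WEdge := fun n => [e] ++ τ n
  have hmemτ : ∀ n g, g ∈ τ n ↔ ∃ i < n, g = mkEdge 0 (i + 2) z := by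
    intro n g
    simp [τ, eq_comm]
  have hinst : ∀ n, IsInstance (σ n) := by
    intro n
    refine isInstance_append (isInstance_singleton (by norm_num) hx)
      (isInstance_star ?_ (by simp) hz) ?_
    · exact List.nodup_range.map (fun a b hab => by simpa using hab)
    · intro g hg g' hg'
      obtain ⟨i, hi, rfl⟩ := (hmemτ n g).1 hg
      rw [List.mem_singleton] at hg'
      subst hg'
      simp only [he, mkEdge, ne_eq, Sym2.eq_iff]
      omega
  have hsucc : ∀ n, σ (n + 1) = σ n ++ [mkEdge 0 (n + 2) z] := by
    intro n
    simp [σ, τ, List.range_succ]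
  let ind : Finset WEdge → ℝ := fun M => if e ∈ M then 1 else 0
  have hE : ∀ n, expect f ∅ (σ n) ind ≤ (1 - p) ^ n := by
    intro n
    induction n with
    | zero =>
      refine (expect_mono (g' := fun _ => 1) fun M _ => ?_).trans (expect_const _ _ _).le
      simp only [ind]
      split_ifs <;> norm_num
    | succ n ih =>
      rw [hsucc, expect_concat]
      refine (expect_mono (g' := fun M => (1 - p) * ind M) fun M hM => ?_).trans ?_
      · have hmat := hM.isMatching isMatching_empty
        have hnew : ∀ g ∈ M, n + 2 ∉ g.ends := by
          intro g hg hgn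
          rcases List.mem_append.1 (hM.mem hg) with h1 | h1
          · rw [List.mem_singleton] at h1
            subst h1
            simp [he] at hgn
          · obtain ⟨i, hi, rfl⟩ := (hmemτ n g).1 h1
            simp at hgn
            omega
        have hne : e ∉ acceptEdge M (mkEdge 0 (n + 2) z) := by
          rw [mem_acceptEdge]
          rintro (h1 | h1)
          · have := congrArg WEdge.ends h1
            simp only [he, mkEdge, Sym2.eq_iff] at this
            omega
          · exact h1.2 (mkEdge_conflicts.2 (Or.inl (by simp [he])))
        by_cases heM : e ∈ M
        · rw [conflictW_of_free_right hnew, hmat.weightsAt_eq heM (v := 0) (by simp [he])]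
          rw [show e.weight = x from rfl, weight_mkEdge, ← hp]
          simp only [ind, heM, hne, if_true, if_false]
          linarith
        · simp [ind, heM, hne]
      · rw [expect_const_mul, pow_succ']
        exact mul_le_mul_of_nonneg_left ih (by linarith)
  -- Every edge contains `0`, so at most one is held: it is `e` or it has weight `z`.
  have hle : ∀ n, x ≤ c * (x * (1 - p) ^ n + z) := by
    intro n
    have h1 := hf.2 (σ n) (hinst n) {e} (by simp [σ]) (isMatching_singleton _)
    rw [totalWeight_singleton] at h1
    refine h1.trans (mul_le_mul_of_nonneg_left ?_ hf.1.le)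
    refine (expect_mono (g' := fun M => x * ind M + z) fun M hM => ?_).trans ?_
    · have hmat := hM.isMatching isMatching_empty
      have h0 : ∀ g ∈ M, 0 ∈ g.ends := by
        intro g hg
        rcases List.mem_append.1 (hM.mem hg) with h1 | h1
        · rw [List.mem_singleton] at h1
          subst h1
          simp [he]
        · obtain ⟨i, hi, rfl⟩ := (hmemτ n g).1 h1
          simp
      rcases M.eq_empty_or_nonempty with rfl | ⟨g, hg⟩
      · simp [totalWeight, ind, hz.le]
      · have hMg : M = {g} := by
          ext g'
          rw [Finset.mem_singleton]
          exact ⟨fun h => hmat.eq_of_mem h hg (h0 _ h) (h0 _ hg), by rintro rfl; exact hg⟩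
        rw [hMg, totalWeight_singleton]
        rcases List.mem_append.1 (hM.mem hg) with h1 | h1
        · rw [List.mem_singleton] at h1
          subst h1
          simp [ind, he, hz.le]
        · obtain ⟨i, hi, rfl⟩ := (hmemτ n g).1 h1
          have : 0 ≤ ind {mkEdge 0 (i + 2) z} := by
            simp only [ind]
            split_ifs <;> norm_num
          have := mul_nonneg hx.le this
          simp only [weight_mkEdge]
          linarith
    · rw [expect_add, expect_const_mul, expect_const]
      gcongr
      exact hE n
  have hlim : Filter.Tendsto (fun n : ℕ => c * (x * (1 - p) ^ n + z)) Filter.atTop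
      (nhds (c * (x * 0 + z))) :=
    (((tendsto_pow_atTop_nhds_zero_of_lt_one (by linarith) (by linarith)).const_mul x).add_const
      z).const_mul c
  have := ge_of_tendsto' hlim hle
  simpa using this

end SingleEdge

/-! ### Hubs: one edge never displaces two when it has the weight of one of them -/

section Hub

variable {f : Multiset ℝ → ℝ → unitInterval} {c : ℝ}

/-- A star edge can push another out of the center only by taking its place, so a hub stays covered
by weight `y` once it is. -/
theorem Reach.exists_mem_of_star {M M' : Finset WEdge} {b : ℕ} {y : ℝ} {l : List ℕ}
    (h : Reach f M (l.map fun v => mkEdge b v y) M') (hM : ∃ g ∈ M, b ∈ g.ends ∧ g.weight = y) :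
    ∃ g ∈ M', b ∈ g.ends ∧ g.weight = y := by
  induction l generalizing M with
  | nil => rw [show M' = M from h]; exact hM
  | cons v l ih =>
    rcases h with ⟨_, h⟩ | h
    · exact ih h ⟨mkEdge b v y, by simp [mem_acceptEdge], by simp, rfl⟩
    · exact ih h hM

open scoped Classical in
/-- The indicator of the event that `e` is in the matching. -/
def memInd (e : WEdge) (M : Finset WEdge) : ℝ := if e ∈ M then 1 else 0

theorem memInd_le_one (e : WEdge) (M : Finset WEdge) : memInd e M ≤ 1 := by
  unfold memInd; split_ifs <;> norm_num

theorem expect_memInd_eq_zero {e : WEdge} {M : Finset WEdge} {σ : List WEdge} (hM : e ∉ M)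
    (hσ : e ∉ σ) : expect f M σ (memInd e) = 0 := by
  rw [← expect_const (f := f) M σ 0]
  refine expect_congr fun M' hM' => ?_
  have : e ∉ M' := fun h => (hM'.subset e h).elim hM hσ
  simp [memInd, this]

theorem expect_memInd_le_one {e : WEdge} {M : Finset WEdge} {σ : List WEdge} :
    expect f M σ (memInd e) ≤ 1 :=
  (expect_mono fun M' _ => memInd_le_one e M').trans (expect_const M σ 1).le

/-- A hub that holds an edge of weight `y` displaces an edge of weight `a` with probability at least
`f {y, a} y` when it is connected to one of its endpoints. -/
theorem expect_memInd_star_le {M : Finset WEdge} (hM : IsMatching M) {b u : ℕ} {y : ℝ}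
    {l : List ℕ} (hb : ∃ g ∈ M, b ∈ g.ends ∧ g.weight = y) {e : WEdge} (hbe : b ∉ e.ends)
    (hu : u ∈ e.ends) (hul : u ∈ l) :
    expect f M (l.map fun v => mkEdge b v y) (memInd e) ≤ 1 - (f {y, e.weight} y : ℝ) := by
  -- Only the edge from the hub to `u` is used. When it arrives, the hub still holds weight `y`; if
  -- `e` is still there, the conflicting weights are exactly `{y, e.weight}`.
  obtain ⟨l₁, l₂, rfl⟩ := List.append_of_mem hul
  have hmem : ∀ l : List ℕ, e ∉ l.map fun v => mkEdge b v y := by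
    intro l h
    obtain ⟨v, _, rfl⟩ := List.mem_map.1 h
    simp at hbe
  rw [List.map_append, expect_append, ← expect_const (f := f) M (l₁.map fun v => mkEdge b v y)
    (1 - (f {y, e.weight} y : ℝ))]
  refine expect_mono fun M₁ hM₁ => ?_
  have hmat := hM₁.isMatching hM
  obtain ⟨g, hg, hbg, hgy⟩ := hM₁.exists_mem_of_star hb
  have hp1 := (f {y, e.weight} y).2.2
  rw [List.map_cons]
  have hacc : e ∉ acceptEdge M₁ (mkEdge b u y) := by
    rw [mem_acceptEdge]
    rintro (rfl | h)
    · simp at hbe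
    · exact h.2 (mkEdge_conflicts.2 (Or.inr hu))
  by_cases he : e ∈ M₁
  · simp only [expect]
    rw [expect_memInd_eq_zero hacc (hmem l₂), conflictW_pair hmat hg he hbg hu
      (by rintro rfl; exact hbe hbg), hgy, weight_mkEdge, mul_zero, zero_add]
    have := expect_memInd_le_one (f := f) (e := e) (M := M₁) (σ := l₂.map fun v => mkEdge b v y)
    exact mul_le_of_le_one_right (by linarith) this
  · rw [expect_memInd_eq_zero he (by simpa using hmem (u :: l₂))]
    linarith

/-- The opening edge from `b` to `b'` meets nothing and is accepted with probability `f 0 y`; this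
arms the hub for the star that follows. -/
theorem expect_memInd_hub_le {M : Finset WEdge} (hM : IsMatching M) {b b' u : ℕ} {y : ℝ}
    {l : List ℕ} (hfree : ∀ g ∈ M, b ∉ g.ends ∧ b' ∉ g.ends) {e : WEdge} (hbe : b ∉ e.ends)
    (hu : u ∈ e.ends) (hul : u ∈ l) :
    expect f M ((b' :: l).map fun v => mkEdge b v y) (memInd e) ≤
      (1 - (f 0 y : ℝ) * (f {y, e.weight} y : ℝ)) * memInd e M := by
  have hmem : e ∉ (b' :: l).map fun v => mkEdge b v y := by
    intro h
    obtain ⟨v, _, rfl⟩ := List.mem_map.1 h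
    simp at hbe
  by_cases he : e ∈ M
  · rw [List.map_cons]
    simp only [expect]
    rw [conflictW_of_free_right fun g hg => (hfree g hg).2,
      weightsAt_eq_zero.2 fun g hg => (hfree g hg).1, weight_mkEdge]
    have h1 := expect_memInd_star_le (f := f) (isMatching_acceptEdge hM (mkEdge b b' y)) (b := b)
      (y := y) (l := l) ⟨mkEdge b b' y, by simp [mem_acceptEdge], by simp, rfl⟩ hbe hu hul
    have h2 := expect_memInd_le_one (f := f) (e := e) (M := M) (σ := l.map fun v => mkEdge b v y)
    have hq0 := (f 0 y).2.1
    have hq1 := (f 0 y).2.2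
    have h3 := mul_le_mul_of_nonneg_left h1 hq0
    have h4 := mul_le_mul_of_nonneg_left h2 (sub_nonneg.2 hq1)
    simp only [memInd, he, if_true]
    linarith
  · rw [expect_memInd_eq_zero he hmem]
    simp [memInd, he]

-- All new edges share `b`, so a matching contains at most one of them. The cost of a hub is thus
-- independent of how many edges it attacks.
open scoped Classical in
theorem weight_sdiff_le_of_hub {M M' S : Finset WEdge} {b : ℕ} {y : ℝ} (hy : 0 ≤ y) {l : List ℕ}
    (hM' : IsMatching M') (hsub : ∀ g ∈ M', g ∈ M ∨ g ∈ l.map fun v => mkEdge b v y)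
    (hpos : ∀ g ∈ M, 0 ≤ g.weight) :
    totalWeight (M' \ S) ≤ totalWeight (M \ S) + y := by
  unfold totalWeight
  have h1 := Finset.sum_filter_add_sum_filter_not (M' \ S) (fun g => g ∈ M) WEdge.weight
  have h2 : ∑ g ∈ (M' \ S).filter (fun g => g ∈ M), g.weight ≤ ∑ g ∈ M \ S, g.weight := by
    refine Finset.sum_le_sum_of_subset_of_nonneg ?_ fun g hg _ => hpos g (by simp at hg; exact hg.1)
    intro g hg
    simp only [Finset.mem_filter, Finset.mem_sdiff] at hg ⊢
    exact ⟨hg.2, hg.1.2⟩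
  have h3 : ∑ g ∈ (M' \ S).filter (fun g => g ∉ M), g.weight ≤ y := by
    have h4 : ∀ g ∈ (M' \ S).filter (fun g => g ∉ M), b ∈ g.ends ∧ g.weight = y ∧ g ∈ M' := by
      intro g hg
      simp only [Finset.mem_filter, Finset.mem_sdiff] at hg
      obtain ⟨v, _, rfl⟩ := List.mem_map.1 ((hsub g hg.1.1).resolve_left hg.2)
      exact ⟨by simp, rfl, hg.1.1⟩
    have h5 : ((M' \ S).filter (fun g => g ∉ M)).card ≤ 1 := by
      rw [Finset.card_le_one]
      intro g hg g' hg'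
      exact hM'.eq_of_mem (h4 g hg).2.2 (h4 g' hg').2.2 (h4 g hg).1 (h4 g' hg').1
    calc _ ≤ ((M' \ S).filter (fun g => g ∉ M)).card • y :=
          Finset.sum_le_card_nsmul _ _ _ fun g hg => (h4 g hg).2.1.le
      _ ≤ y := by
          rw [nsmul_eq_mul]
          exact mul_le_of_le_one_left hy (by exact_mod_cast h5)
  linarith

/-- The edges of a matching of size `n` in which all edges have weight `a`. -/
def baseEdge (a : ℝ) (i : ℕ) : WEdge := mkEdge (2 * i) (2 * i + 1) a

theorem baseEdge_injective (a : ℝ) : Function.Injective (baseEdge a) := by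
  intro i j h
  have := congrArg WEdge.ends h
  simp only [baseEdge, mkEdge, Sym2.eq_iff] at this
  omega

open scoped Classical in
/-- The adversary can build, on `n` disjoint edges of weight `a`, an input after which each of these
edges is held with probability at most `r`, and on which the other edges that are held have bounded
total weight. -/
def Reducible (f : Multiset ℝ → ℝ → unitInterval) (a r : ℝ) : Prop :=
  ∃ C : ℝ, ∀ n : ℕ, ∃ σ : List WEdge, IsInstance σ ∧ (∀ i < n, baseEdge a i ∈ σ) ∧
    (∀ i < n, expect f ∅ σ (memInd (baseEdge a i)) ≤ r) ∧
    ∀ M, Reach f ∅ σ M → totalWeight (M \ (Finset.range n).image (baseEdge a)) ≤ C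

theorem reducible_one (f : Multiset ℝ → ℝ → unitInterval) {a : ℝ} (ha : 0 < a) :
    Reducible f a 1 := by
  classical
  refine ⟨0, fun n => ⟨(List.range n).map (baseEdge a), ⟨fun e he => ?_, ?_⟩, ?_, ?_, ?_⟩⟩
  · obtain ⟨i, _, rfl⟩ := List.mem_map.1 he
    exact ⟨by simp [baseEdge, mkEdge], ha⟩
  · rw [List.map_map]
    refine List.nodup_range.map fun i j h => ?_
    simp only [Function.comp, baseEdge, mkEdge, Sym2.eq_iff] at h
    omega
  · intro i hi
    exact List.mem_map.2 ⟨i, List.mem_range.2 hi, rfl⟩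
  · exact fun i _ => expect_memInd_le_one
  · intro M hM
    have : M \ (Finset.range n).image (baseEdge a) = ∅ := by
      rw [Finset.sdiff_eq_empty_iff_subset]
      intro g hg
      simpa using hM.mem hg
    rw [this]
    simp [totalWeight]

/-- One fresh hub, joined to one endpoint of each base edge, multiplies all survival bounds by the
same factor and adds only `y` to the weight held elsewhere. -/
theorem Reducible.step {a r y : ℝ} (hy : 0 < y) (h : Reducible f a r) :
    Reducible f a ((1 - (f 0 y : ℝ) * (f {y, a} y : ℝ)) * r) := by
  classical
  obtain ⟨C, hC⟩ := h
  refine ⟨C + y, fun n => ?_⟩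
  obtain ⟨σ, hσ, hmem, hE, hrest⟩ := hC n
  obtain ⟨B, hB⟩ := exists_vertex_bound σ
  -- Larger than all vertices of `σ` and than all attacked endpoints `2 * i`; the partner of the hub
  -- is `b + 1`.
  set b := B + 2 * n with hb
  let l : List ℕ := (List.range n).map (2 * ·)
  let τ : List WEdge := ((b + 1) :: l).map fun v => mkEdge b v y
  have hl : ∀ v ∈ l, v < b := by
    intro v hv
    obtain ⟨i, hi, rfl⟩ := List.mem_map.1 hv
    have := List.mem_range.1 hi
    simp only [hb]
    omega
  have hτ : IsInstance τ := by
    refine isInstance_star ?_ ?_ hy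
    · rw [List.nodup_cons]
      refine ⟨fun h => ?_, List.nodup_range.map fun i j h => by simpa using h⟩
      have := hl _ h
      omega
    · intro h
      rcases List.mem_cons.1 h with h | h
      · omega
      · exact (hl _ h).ne rfl
  have hnot : ∀ i < n, b ∉ (baseEdge a i).ends := by
    intro i hi h
    simp only [baseEdge, mem_ends_mkEdge] at h
    omega
  refine ⟨σ ++ τ, isInstance_append hσ hτ ?_, fun i hi => by simp [hmem i hi], fun i hi => ?_, ?_⟩
  · intro e he g hg heq
    obtain ⟨v, _, rfl⟩ := List.mem_map.1 he
    have := hB g hg b (heq ▸ (by simp : b ∈ (mkEdge b v y).ends))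
    omega
  · rw [expect_append]
    calc _ ≤ expect f ∅ σ (fun M => (1 - (f 0 y : ℝ) * (f {y, a} y : ℝ)) *
          memInd (baseEdge a i) M) := by
          refine expect_mono fun M hM => ?_
          refine expect_memInd_hub_le (hM.isMatching isMatching_empty) ?_ (hnot i hi)
            (u := 2 * i) (by simp [baseEdge]) (List.mem_map.2 ⟨i, List.mem_range.2 hi, rfl⟩)
          intro g hg
          constructor
          · intro h
            have := hB g (hM.mem hg) _ h
            omega
          · intro h
            have := hB g (hM.mem hg) _ h
            omega
      _ ≤ _ := by
          rw [expect_const_mul]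
          refine mul_le_mul_of_nonneg_left (hE i hi) (sub_nonneg.2 ?_)
          exact mul_le_one₀ (f 0 y).2.2 (f {y, a} y).2.1 (f {y, a} y).2.2
  · intro M' hM'
    obtain ⟨M, hM, hMM'⟩ := reach_append.1 hM'
    have := weight_sdiff_le_of_hub (S := (Finset.range n).image (baseEdge a)) hy.le
      (hM'.isMatching isMatching_empty) hMM'.subset fun g hg => (hσ.1 g (hM.mem hg)).2.le
    linarith [hrest M hM]

/-- The base edges form a matching of weight `n * a`, against which the algorithm has at most `n * a
* r + C`. As `C` does not depend on `n`, it disappears for large `n`. -/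
theorem LocalCompetitive.one_le_of_reducible (hf : LocalCompetitive f c) {a r : ℝ} (ha : 0 < a)
    (h : Reducible f a r) : 1 ≤ c * r := by
  classical
  obtain ⟨C, hC⟩ := h
  have key : ∀ n : ℕ, a * (1 - c * r) * n ≤ c * C := by
    intro n
    obtain ⟨σ, hσ, hmem, hE, hrest⟩ := hC n
    set S := (Finset.range n).image (baseEdge a) with hS
    have hSm : IsMatching S := by
      intro e he g hg hne
      simp only [hS, Finset.coe_image, Set.mem_image, Finset.coe_range, Set.mem_Iio] at he hg
      obtain ⟨i, _, rfl⟩ := he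
      obtain ⟨j, _, rfl⟩ := hg
      have hij : i ≠ j := by rintro rfl; exact hne rfl
      simp only [baseEdge]
      rw [mkEdge_conflicts]
      simp only [mem_ends_mkEdge]
      omega
    have h1 := hf.2 σ hσ S (by
      intro e he
      obtain ⟨i, hi, rfl⟩ := Finset.mem_image.1 he
      exact hmem i (Finset.mem_range.1 hi)) hSm
    have h2 : totalWeight S = n * a := by
      unfold totalWeight
      rw [hS, Finset.sum_image fun i _ j _ h => baseEdge_injective a h]
      simp [baseEdge]
    have h3 : expect f ∅ σ totalWeight ≤ a * (n * r) + C := by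
      calc _ ≤ expect f ∅ σ (fun M =>
            a * (∑ i ∈ Finset.range n, memInd (baseEdge a i) M) + C) := by
            refine expect_mono fun M hM => ?_
            have h4 : totalWeight M = totalWeight (M ∩ S) + totalWeight (M \ S) := by
              unfold totalWeight
              rw [← Finset.sum_inter_add_sum_sdiff M S]
            have h5 : totalWeight (M ∩ S) =
                a * ∑ i ∈ Finset.range n, memInd (baseEdge a i) M := by
              unfold totalWeight memInd
              rw [Finset.inter_comm, ← Finset.filter_mem_eq_inter, Finset.sum_filter, hS,
                Finset.sum_image fun i _ j _ h => baseEdge_injective a h, Finset.mul_sum]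
              refine Finset.sum_congr rfl fun i _ => ?_
              split_ifs <;> simp [baseEdge]
            rw [h4, h5]
            linarith [hrest M hM]
        _ ≤ _ := by
            rw [expect_add, expect_const, expect_const_mul, expect_sum]
            gcongr
            calc _ ≤ ∑ i ∈ Finset.range n, r :=
                  Finset.sum_le_sum fun i hi => hE i (Finset.mem_range.1 hi)
              _ = n * r := by simp
    have h4 := mul_le_mul_of_nonneg_left h3 hf.1.le
    rw [h2] at h1
    nlinarith
  by_contra hlt
  have hpos : 0 < a * (1 - c * r) := mul_pos ha (by linarith)
  obtain ⟨n, hn⟩ := exists_nat_gt (c * C / (a * (1 - c * r)))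
  rw [div_lt_iff₀ hpos] at hn
  linarith [key n]

/-- A competitive local algorithm does not give up two edges for one edge whose weight is that of one
of them. -/
theorem LocalCompetitive.accept_pair_eq_zero (hf : LocalCompetitive f c) {a y : ℝ} (ha : 0 < a)
    (hy : 0 < y) : (f {y, a} y : ℝ) = 0 := by
  by_contra hne
  have hp : 0 < (f {y, a} y : ℝ) := lt_of_le_of_ne (f {y, a} y).2.1 (Ne.symm hne)
  have hq := hf.accept_free_pos hy
  set t := (f 0 y : ℝ) * (f {y, a} y : ℝ) with ht
  have ht0 : 0 < t := mul_pos hq hp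
  have ht1 : t ≤ 1 := mul_le_one₀ (f 0 y).2.2 (f {y, a} y).2.1 (f {y, a} y).2.2
  have hred : ∀ k : ℕ, Reducible f a ((1 - t) ^ k) := by
    intro k
    induction k with
    | zero => simpa using reducible_one f ha
    | succ k ih => rw [pow_succ']; exact ih.step hy
  have hlim : Filter.Tendsto (fun k : ℕ => c * (1 - t) ^ k) Filter.atTop (nhds (c * 0)) :=
    (tendsto_pow_atTop_nhds_zero_of_lt_one (by linarith) (by linarith)).const_mul c
  have := ge_of_tendsto' hlim fun k => hf.one_le_of_reducible ha (hred k)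
  norm_num at this

end Hub

/-! ### Pendant edges of a rejected weight -/

section Pendant

variable {f : Multiset ℝ → ℝ → unitInterval} {c : ℝ}

open scoped Classical in
/-- The vertices of `V` at which the weights of the edges of `M` are not given by `m`. -/
def deviating (m : Multiset ℝ) (V : Finset ℕ) (M : Finset WEdge) : Finset ℕ :=
  V.filter fun v => weightsAt M v ≠ m

theorem mem_deviating {m : Multiset ℝ} {V : Finset ℕ} {M : Finset WEdge} {v : ℕ} :
    v ∈ deviating m V M ↔ v ∈ V ∧ weightsAt M v ≠ m := by
  simp [deviating]

theorem weightsAt_acceptEdge_of_notMem {M : Finset WEdge} {e : WEdge} {v : ℕ} (hv : v ∉ e.ends)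
    (h : ∀ g ∈ M, v ∈ g.ends → ¬ e.Conflicts g) : weightsAt (acceptEdge M e) v = weightsAt M v := by
  refine weightsAt_congr fun g hg => ?_
  rw [mem_acceptEdge]
  constructor
  · rintro (rfl | h1)
    · exact absurd hg hv
    · exact h1.1
  · exact fun h1 => Or.inr ⟨h1, h g h1 hg⟩

/-- Acceptance shows that `u` does not see `m`. A discarded edge contains `u`; if it also contained
`v`, both vertices would see the same single weight, and `u` would see `m`. -/
theorem weightsAt_acceptEdge_pendant {m : Multiset ℝ} {M : Finset WEdge} (hM : IsMatching M)
    {b u v : ℕ} {z : ℝ} (hfz : (f m z : ℝ) = 0) (hv : v < b)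
    (hfresh : ∀ g ∈ M, b + u ∉ g.ends) (hacc : 0 < (f (conflictW M (mkEdge u (b + u) z)) z : ℝ))
    (hvm : weightsAt M v = m) : weightsAt (acceptEdge M (mkEdge u (b + u) z)) v = m := by
  rw [conflictW_of_free_right hfresh] at hacc
  have hum : weightsAt M u ≠ m := by
    intro h
    rw [h, hfz] at hacc
    exact lt_irrefl _ hacc
  rw [weightsAt_acceptEdge_of_notMem, hvm]
  · rw [mem_ends_mkEdge]
    rintro (rfl | rfl)
    · exact hum hvm
    · omega
  · intro g hg hvg hc
    rcases mkEdge_conflicts.1 hc with h | h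
    · rw [hM.weightsAt_eq hg h, ← hM.weightsAt_eq hg hvg] at hum
      exact hum hvm
    · exact hfresh g hg h

theorem totalWeight_acceptEdge_le {M : Finset WEdge} (hpos : ∀ g ∈ M, 0 ≤ g.weight) (e : WEdge) :
    totalWeight (acceptEdge M e) ≤ totalWeight M + e.weight := by
  classical
  unfold totalWeight
  rw [sum_acceptEdge, add_comm]
  refine add_le_add_left ?_ _
  exact Finset.sum_le_sum_of_subset_of_nonneg (Finset.filter_subset (fun h => ¬ e.Conflicts h) M)
    fun g hg _ => hpos g hg

theorem pendant_fresh_acceptEdge {M : Finset WEdge} {b u : ℕ} {z : ℝ} {l : List ℕ}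
    (hl : ∀ v ∈ u :: l, v < b) (hnd : (u :: l).Nodup)
    (hfresh : ∀ g ∈ M, ∀ v ∈ u :: l, b + v ∉ g.ends) :
    ∀ g ∈ acceptEdge M (mkEdge u (b + u) z), ∀ v ∈ l, b + v ∉ g.ends := by
  intro g hg v hv
  rcases mem_acceptEdge.1 hg with rfl | h
  · rw [mem_ends_mkEdge]
    rintro (h | h)
    · have := hl u (by simp)
      omega
    · have : v = u := by omega
      exact (List.nodup_cons.1 hnd).1 (this ▸ hv)
  · exact hfresh g h.1 v (by simp [hv])

theorem Reach.weightsAt_pendants {m : Multiset ℝ} {M M' : Finset WEdge} (hM : IsMatching M)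
    {b : ℕ} {z : ℝ} (hfz : (f m z : ℝ) = 0) {l : List ℕ} (hl : ∀ v ∈ l, v < b) (hnd : l.Nodup)
    (hfresh : ∀ g ∈ M, ∀ v ∈ l, b + v ∉ g.ends)
    (h : Reach f M (l.map fun u => mkEdge u (b + u) z) M') {v : ℕ} (hv : v < b)
    (hvm : weightsAt M v = m) : weightsAt M' v = m := by
  induction l generalizing M with
  | nil => rw [show M' = M from h]; exact hvm
  | cons u l ih =>
    have hl' : ∀ v ∈ l, v < b := fun v hv => hl v (by simp [hv])
    rcases h with ⟨hp, h⟩ | h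
    · exact ih (isMatching_acceptEdge hM _) hl' hnd.of_cons (pendant_fresh_acceptEdge hl hnd hfresh)
        h (weightsAt_acceptEdge_pendant hM hfz hv (fun g hg => hfresh g hg u (by simp)) hp hvm)
    · exact ih hM hl' hnd.of_cons (fun g hg v hv => hfresh g hg v (by simp [hv])) h hvm

/-- Only a deviating vertex can accept its pendant, at a gain of at most `z`. Acceptance creates no
deviating vertex among those still to come, so each deviating vertex is paid for once. -/
theorem expect_totalWeight_pendants_le {m : Multiset ℝ} {M : Finset WEdge} (hM : IsMatching M)
    (hpos : ∀ g ∈ M, 0 ≤ g.weight) {b : ℕ} {z : ℝ} (hz : 0 ≤ z) (hfz : (f m z : ℝ) = 0)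
    {l : List ℕ} (hl : ∀ v ∈ l, v < b) (hnd : l.Nodup)
    (hfresh : ∀ g ∈ M, ∀ v ∈ l, b + v ∉ g.ends) :
    expect f M (l.map fun u => mkEdge u (b + u) z) totalWeight ≤
      totalWeight M + z * (deviating m l.toFinset M).card := by
  classical
  induction l generalizing M with
  | nil => simp [expect, deviating]
  | cons u l ih =>
    have hl' : ∀ v ∈ l, v < b := fun v hv => hl v (by simp [hv])
    have hfu : ∀ g ∈ M, b + u ∉ g.ends := fun g hg => hfresh g hg u (by simp)
    have ih2 := ih hM hpos hl' hnd.of_cons fun g hg v hv => hfresh g hg v (by simp [hv])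
    have hsub : deviating m l.toFinset M ⊆ deviating m (u :: l).toFinset M := by
      intro v hv
      rw [mem_deviating] at hv ⊢
      exact ⟨by simp only [List.toFinset_cons, Finset.mem_insert]; exact Or.inr hv.1, hv.2⟩
    have hcard : ((deviating m l.toFinset M).card : ℝ) ≤ (deviating m (u :: l).toFinset M).card :=
      by exact_mod_cast Finset.card_le_card hsub
    rw [List.map_cons]
    simp only [expect]
    set p : ℝ := ((f (conflictW M (mkEdge u (b + u) z)) (mkEdge u (b + u) z).weight :
      unitInterval) : ℝ) with hp
    have hp0 : 0 ≤ p := (f _ _).2.1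
    have hp1 : p ≤ 1 := (f _ _).2.2
    have h2 : expect f M (l.map fun u => mkEdge u (b + u) z) totalWeight ≤
        totalWeight M + z * (deviating m (u :: l).toFinset M).card :=
      ih2.trans (by gcongr)
    rcases hp0.eq_or_lt with h0 | h0
    · rw [← h0]
      linarith
    · have hum : weightsAt M u ≠ m := by
        intro h
        rw [hp, conflictW_of_free_right hfu, h, weight_mkEdge, hfz] at h0
        exact lt_irrefl _ h0
      have ih1 := ih (isMatching_acceptEdge hM (mkEdge u (b + u) z)) (by
        intro g hg
        rcases mem_acceptEdge.1 hg with rfl | h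
        · exact hz
        · exact hpos g h.1) hl' hnd.of_cons (pendant_fresh_acceptEdge hl hnd hfresh)
      have hsub' : insert u (deviating m l.toFinset (acceptEdge M (mkEdge u (b + u) z))) ⊆
          deviating m (u :: l).toFinset M := by
        intro v hv
        rcases Finset.mem_insert.1 hv with rfl | hv
        · exact mem_deviating.2 ⟨by simp, hum⟩
        · rw [mem_deviating] at hv ⊢
          refine ⟨by simp only [List.toFinset_cons, Finset.mem_insert]; exact Or.inr hv.1,
            fun h => hv.2 ?_⟩
          exact weightsAt_acceptEdge_pendant hM hfz (hl' v (List.mem_toFinset.1 hv.1)) hfu h0 h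
      have hcard' : ((deviating m l.toFinset (acceptEdge M (mkEdge u (b + u) z))).card : ℝ) + 1 ≤
          (deviating m (u :: l).toFinset M).card := by
        have := Finset.card_le_card hsub'
        rw [Finset.card_insert_of_notMem (by
          rw [mem_deviating, List.mem_toFinset]
          exact fun h => (List.nodup_cons.1 hnd).1 h.1)] at this
        exact_mod_cast this
      have h1 : expect f (acceptEdge M (mkEdge u (b + u) z))
          (l.map fun u => mkEdge u (b + u) z) totalWeight ≤
          totalWeight M + z * (deviating m (u :: l).toFinset M).card := by
        have h3 := totalWeight_acceptEdge_le hpos (mkEdge u (b + u) z)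
        have h4 := mul_le_mul_of_nonneg_left hcard' hz
        rw [weight_mkEdge] at h3
        linarith
      have h3 := mul_le_mul_of_nonneg_left h1 hp0
      have h4 := mul_le_mul_of_nonneg_left h2 (sub_nonneg.2 hp1)
      linarith

end Pendant

/-! ### Matchings during a stage: old edges and new edges into `W` -/

section Stage

variable {f : Multiset ℝ → ℝ → unitInterval} {c : ℝ}

/-- The edge has an endpoint in `W`. -/
def Touches (W : Finset ℕ) (g : WEdge) : Prop := ∃ w ∈ W, w ∈ g.ends

open scoped Classical in
/-- The number of edges of `M` with an endpoint in `W`. -/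
def touchCount (W : Finset ℕ) (M : Finset WEdge) : ℕ := (M.filter (Touches W)).card

open scoped Classical in
/-- The total weight of the edges of `M` without endpoints in `W`. -/
def oldWeight (W : Finset ℕ) (M : Finset WEdge) : ℝ := totalWeight (M.filter fun g => ¬ Touches W g)

open scoped Classical in
/-- The vertices of `V` at which `M` has the weights `m`, on edges that do not meet `W`. -/
def untouched (m : Multiset ℝ) (V W : Finset ℕ) (M : Finset WEdge) : Finset ℕ :=
  V.filter fun v => weightsAt M v = m ∧ ∀ g ∈ M, v ∈ g.ends → ¬ Touches W g

theorem mem_untouched {m : Multiset ℝ} {V W : Finset ℕ} {M : Finset WEdge} {v : ℕ} :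
    v ∈ untouched m V W M ↔
      v ∈ V ∧ weightsAt M v = m ∧ ∀ g ∈ M, v ∈ g.ends → ¬ Touches W g := by
  simp [untouched]

/-- A matching in which no edge joins two vertices of `V`, and the edges that meet `W` join `V`
and `W` and have weight `y`. -/
structure StageMatching (V W : Finset ℕ) (y : ℝ) (M : Finset WEdge) : Prop where
  isMatching : IsMatching M
  pos : ∀ g ∈ M, 0 < g.weight
  eq_of_mem : ∀ g ∈ M, ∀ v ∈ V, ∀ v' ∈ V, v ∈ g.ends → v' ∈ g.ends → v = v'
  new : ∀ g ∈ M, Touches W g → ∃ v ∈ V, ∃ w ∈ W, g = mkEdge v w y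

theorem touches_mkEdge {W : Finset ℕ} {v w : ℕ} {y : ℝ} (hw : w ∈ W) : Touches W (mkEdge v w y) :=
  ⟨w, hw, by simp⟩

variable {V W : Finset ℕ} {y : ℝ} {m : Multiset ℝ} {M : Finset WEdge}

-- Each new edge held has exactly one endpoint in `V`; double counting this incidence, here and for
-- `W` in `card_right`, lets edges be counted by covered vertices.
open scoped Classical in
theorem StageMatching.card_left (hM : StageMatching V W y M) :
    (V.filter fun v => ∃ g ∈ M, Touches W g ∧ v ∈ g.ends).card = touchCount W M := by
  unfold touchCount
  apply le_antisymm
  · refine Finset.card_le_card_of_forall_subsingleton (fun v g => v ∈ g.ends) ?_ ?_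
    · intro v hv
      obtain ⟨hv, g, hg, h1, h2⟩ := by simpa using hv
      exact ⟨g, by simp [hg, h1], h2⟩
    · intro g hg v hv v' hv'
      simp only [Finset.mem_filter] at hg
      simp only [Set.mem_ofPred_eq, Finset.mem_filter] at hv hv'
      exact hM.eq_of_mem g hg.1 v hv.1.1 v' hv'.1.1 hv.2 hv'.2
  · refine Finset.card_le_card_of_forall_subsingleton (fun g v => v ∈ g.ends) ?_ ?_
    · intro g hg
      simp only [Finset.mem_filter] at hg
      obtain ⟨v, hv, w, hw, rfl⟩ := hM.new g hg.1 hg.2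
      exact ⟨v, by simp only [Finset.mem_filter]; exact ⟨hv, _, hg.1, hg.2, by simp⟩, by simp⟩
    · intro v hv g hg g' hg'
      simp only [Set.mem_ofPred_eq, Finset.mem_filter] at hg hg'
      exact hM.isMatching.eq_of_mem hg.1.1 hg'.1.1 hg.2 hg'.2

open scoped Classical in
theorem StageMatching.card_right (hM : StageMatching V W y M) (hVW : Disjoint V W) :
    (W.filter fun w => ∃ g ∈ M, w ∈ g.ends).card = touchCount W M := by
  unfold touchCount
  apply le_antisymm
  · refine Finset.card_le_card_of_forall_subsingleton (fun w g => w ∈ g.ends) ?_ ?_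
    · intro w hw
      obtain ⟨hw, g, hg, h2⟩ := by simpa using hw
      exact ⟨g, by simp only [Finset.mem_filter]; exact ⟨hg, w, hw, h2⟩, h2⟩
    · intro g hg w hw w' hw'
      simp only [Finset.mem_filter] at hg
      simp only [Set.mem_ofPred_eq, Finset.mem_filter] at hw hw'
      obtain ⟨v, hv, w₀, hw₀, rfl⟩ := hM.new g hg.1 hg.2
      have h1 : ∀ t ∈ W, t ∈ (mkEdge v w₀ y).ends → t = w₀ := by
        intro t ht h
        rcases mem_ends_mkEdge.1 h with rfl | rfl
        · exact absurd ht (Finset.disjoint_left.1 hVW hv)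
        · rfl
      rw [h1 w hw.1.1 hw.2, h1 w' hw'.1.1 hw'.2]
  · refine Finset.card_le_card_of_forall_subsingleton (fun g w => w ∈ g.ends) ?_ ?_
    · intro g hg
      simp only [Finset.mem_filter] at hg
      obtain ⟨v, hv, w, hw, rfl⟩ := hM.new g hg.1 hg.2
      exact ⟨w, by simp only [Finset.mem_filter]; exact ⟨hw, _, hg.1, by simp⟩, by simp⟩
    · intro v hv g hg g' hg'
      simp only [Set.mem_ofPred_eq, Finset.mem_filter] at hg hg'
      exact hM.isMatching.eq_of_mem hg.1.1 hg'.1.1 hg.2 hg'.2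


end Stage

/-! ### The effect of one accepted edge in a stage -/

section StageStep

variable {f : Multiset ℝ → ℝ → unitInterval} {V W : Finset ℕ} {y : ℝ} {m : Multiset ℝ}
  {M : Finset WEdge} {v w : ℕ}

/-- An accepted edge conflicts with at most one edge of the matching. -/
theorem StageMatching.free_or_free (hM : StageMatching V W y M) (hVW : Disjoint V W)
    (hkill : ∀ a, 0 < a → (f {y, a} y : ℝ) = 0) (hv : v ∈ V) (hw : w ∈ W)
    (hends : ∀ g ∈ M, g.ends ≠ (mkEdge v w y).ends)
    (hacc : 0 < (f (conflictW M (mkEdge v w y)) y : ℝ)) :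
    (∀ g ∈ M, w ∉ g.ends) ∨
      ((∀ g ∈ M, v ∉ g.ends) ∧ ∃ v' ∈ V, v' ≠ v ∧ mkEdge v' w y ∈ M) := by
  by_cases hfw : ∀ g ∈ M, w ∉ g.ends
  · exact Or.inl hfw
  · push Not at hfw
    obtain ⟨g, hg, hwg⟩ := hfw
    obtain ⟨v', hv', w', hw', rfl⟩ := hM.new g hg ⟨w, hw, hwg⟩
    have hww' : w = w' := by
      rcases mem_ends_mkEdge.1 hwg with h | h
      · exact absurd (h ▸ hw) (Finset.disjoint_left.1 hVW hv')
      · exact h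
    subst hww'
    have hvv' : v' ≠ v := by
      rintro rfl
      exact hends _ hg rfl
    refine Or.inr ⟨fun h hh hvh => ?_, v', hv', hvv', hg⟩
    have hne : mkEdge v' w y ≠ h := by
      rintro rfl
      exact hvv' (hM.eq_of_mem _ hg v' hv' v hv (by simp) hvh)
    -- The edge would displace both the `y`-edge at `w` and an edge at `v`, which `hkill` forbids.
    rw [mkEdge_comm, conflictW_pair hM.isMatching hg hh hwg hvh hne, weight_mkEdge,
      hkill _ (hM.pos h hh)] at hacc
    exact lt_irrefl _ hacc

open scoped Classical in
theorem touchCount_acceptEdge (hw : w ∈ W) :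
    touchCount W (acceptEdge M (mkEdge v w y)) =
      ((M.filter (Touches W)).filter fun g => ¬ (mkEdge v w y).Conflicts g).card + 1 := by
  unfold touchCount acceptEdge
  rw [Finset.filter_insert, if_pos (touches_mkEdge hw), Finset.card_insert_of_notMem (by
    simp [WEdge.conflicts_self]), Finset.filter_comm]

open scoped Classical in
theorem oldWeight_acceptEdge (hw : w ∈ W) :
    oldWeight W (acceptEdge M (mkEdge v w y)) = totalWeight
      ((M.filter fun g => ¬ Touches W g).filter fun g => ¬ (mkEdge v w y).Conflicts g) := by
  unfold oldWeight acceptEdge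
  rw [Finset.filter_insert, if_neg (not_not.2 (touches_mkEdge hw)), Finset.filter_comm]

theorem oldWeight_acceptEdge_le (hpos : ∀ g ∈ M, 0 < g.weight) (hw : w ∈ W) :
    oldWeight W (acceptEdge M (mkEdge v w y)) ≤ oldWeight W M := by
  classical
  rw [oldWeight_acceptEdge hw]
  unfold oldWeight totalWeight
  exact Finset.sum_le_sum_of_subset_of_nonneg (Finset.filter_subset _ _) fun g hg _ =>
    (hpos g (Finset.filter_subset _ _ hg)).le

/-- The edges at an untouched `u` meet neither `W` nor another vertex of `V`, hence not the new
edge. -/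
theorem StageMatching.mem_untouched_acceptEdge (hM : StageMatching V W y M) (hVW : Disjoint V W)
    (hv : v ∈ V) (hw : w ∈ W) {u : ℕ} (hu : u ∈ untouched m V W M) (huv : u ≠ v) :
    u ∈ untouched m V W (acceptEdge M (mkEdge v w y)) := by
  rw [mem_untouched] at hu ⊢
  have hue : u ∉ (mkEdge v w y).ends := by
    rw [mem_ends_mkEdge]
    rintro (h | rfl)
    · exact huv h
    · exact Finset.disjoint_left.1 hVW hu.1 hw
  refine ⟨hu.1, ?_, ?_⟩
  · rw [weightsAt_acceptEdge_of_notMem hue, hu.2.1]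
    intro g hg hug hc
    rcases mkEdge_conflicts.1 hc with h | h
    · exact huv (hM.eq_of_mem g hg u hu.1 v hv hug h)
    · exact hu.2.2 g hg hug ⟨w, hw, h⟩
  · intro g hg hug
    rcases mem_acceptEdge.1 hg with rfl | h
    · exact absurd hug hue
    · exact hu.2.2 g h.1 hug

theorem StageMatching.card_untouched_le (hM : StageMatching V W y M) (hVW : Disjoint V W)
    (hv : v ∈ V) (hw : w ∈ W) : (untouched m V W M).card ≤
      (untouched m V W (acceptEdge M (mkEdge v w y))).card + 1 := by
  have h : (untouched m V W M).erase v ⊆ untouched m V W (acceptEdge M (mkEdge v w y)) := by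
    intro u hu
    rw [Finset.mem_erase] at hu
    exact hM.mem_untouched_acceptEdge hVW hv hw hu.2 hu.1
  have := Finset.card_le_card h
  have := Finset.pred_card_le_card_erase (s := untouched m V W M) (a := v)
  omega

theorem touchCount_acceptEdge_of_untouched (hv : v ∈ untouched m V W M) (hw : w ∈ W)
    (hfree : ∀ g ∈ M, w ∉ g.ends) :
    touchCount W (acceptEdge M (mkEdge v w y)) = touchCount W M + 1 := by
  classical
  rw [touchCount_acceptEdge hw]
  unfold touchCount
  congr 2
  rw [Finset.filter_eq_self]
  intro g hg hc
  rw [Finset.mem_filter] at hg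
  rcases mkEdge_conflicts.1 hc with h | h
  · exact (mem_untouched.1 hv).2.2 g hg.1 h hg.2
  · exact hfree g hg.1 h

theorem oldWeight_acceptEdge_of_untouched (hv : v ∈ untouched m V W M) (hw : w ∈ W)
    (hfree : ∀ g ∈ M, w ∉ g.ends) :
    oldWeight W (acceptEdge M (mkEdge v w y)) = oldWeight W M - m.sum := by
  classical
  rw [oldWeight_acceptEdge hw, eq_sub_iff_add_eq]
  unfold oldWeight totalWeight
  rw [← Finset.sum_filter_not_add_sum_filter (M.filter fun g => ¬ Touches W g)
    (fun g => (mkEdge v w y).Conflicts g)]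
  congr 1
  rw [← (mem_untouched.1 hv).2.1]
  have : (M.filter fun g => ¬ Touches W g).filter (fun g => (mkEdge v w y).Conflicts g) =
      M.filter fun g => v ∈ g.ends := by
    ext g
    simp only [Finset.mem_filter, mkEdge_conflicts]
    constructor
    · rintro ⟨⟨hg, _⟩, h⟩
      exact ⟨hg, h.resolve_right (hfree g hg)⟩
    · rintro ⟨hg, h⟩
      exact ⟨⟨hg, (mem_untouched.1 hv).2.2 g hg h⟩, Or.inl h⟩
  rw [this, weightsAt]
  rfl

theorem StageMatching.touchCount_le (hM : StageMatching V W y M)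
    (hw : w ∈ W) (h : (∀ g ∈ M, w ∉ g.ends) ∨ ∀ g ∈ M, v ∉ g.ends) :
    touchCount W M ≤ touchCount W (acceptEdge M (mkEdge v w y)) := by
  classical
  rw [touchCount_acceptEdge hw]
  unfold touchCount
  rw [← Finset.card_filter_add_card_filter_not (s := M.filter (Touches W))
    (fun g => (mkEdge v w y).Conflicts g), add_comm]
  refine Nat.add_le_add_left ?_ _
  rw [Finset.card_le_one]
  intro g hg g' hg'
  simp only [Finset.mem_filter, mkEdge_conflicts] at hg hg'
  rcases h with h | h
  · exact hM.isMatching.eq_of_mem hg.1.1 hg'.1.1 (hg.2.resolve_right (h g hg.1.1))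
      (hg'.2.resolve_right (h g' hg'.1.1))
  · exact hM.isMatching.eq_of_mem hg.1.1 hg'.1.1 (hg.2.resolve_left (h g hg.1.1))
      (hg'.2.resolve_left (h g' hg'.1.1))

/-- The new edge replaces the one from `v'` to `w`. If `m = 0`, then `v'` becomes untouched in
exchange for `v`; if `m ≠ 0`, the free vertex `v` was not untouched to begin with. -/
theorem StageMatching.card_untouched_le_of_free (hM : StageMatching V W y M) (hVW : Disjoint V W)
    (hv : v ∈ V) (hw : w ∈ W) (hfree : ∀ g ∈ M, v ∉ g.ends) {v' : ℕ} (hv' : v' ∈ V)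
    (hne : v' ≠ v) (hmem : mkEdge v' w y ∈ M) : (untouched m V W M).card ≤
      (untouched m V W (acceptEdge M (mkEdge v w y))).card := by
  have hw0 : weightsAt M v = 0 := weightsAt_eq_zero.2 hfree
  have hv'X : v' ∉ untouched m V W M := fun h =>
    (mem_untouched.1 h).2.2 _ hmem (by simp) (touches_mkEdge hw)
  by_cases hm : m = 0
  · subst hm
    have hsub : insert v' ((untouched 0 V W M).erase v) ⊆
        untouched 0 V W (acceptEdge M (mkEdge v w y)) := by
      intro u hu
      rcases Finset.mem_insert.1 hu with rfl | hu
      · have : ∀ g ∈ acceptEdge M (mkEdge v w y), u ∉ g.ends := by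
          intro g hg hug
          rcases mem_acceptEdge.1 hg with rfl | h
          · rcases mem_ends_mkEdge.1 hug with h | rfl
            · exact hne h
            · exact Finset.disjoint_left.1 hVW hv' hw
          · rw [hM.isMatching.eq_of_mem h.1 hmem hug (by simp)] at h
            exact h.2 (mkEdge_conflicts.2 (Or.inr (by simp)))
        exact mem_untouched.2 ⟨hv', weightsAt_eq_zero.2 this, fun g hg h => absurd h (this g hg)⟩
      · rw [Finset.mem_erase] at hu
        exact hM.mem_untouched_acceptEdge hVW hv hw hu.2 hu.1
    have h1 := Finset.card_le_card hsub
    rw [Finset.card_insert_of_notMem fun h => hv'X (Finset.mem_of_mem_erase h)] at h1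
    have := Finset.pred_card_le_card_erase (s := untouched 0 V W M) (a := v)
    omega
  · refine Finset.card_le_card fun u hu => hM.mem_untouched_acceptEdge hVW hv hw hu ?_
    rintro rfl
    exact hm ((mem_untouched.1 hu).2.1.symm.trans hw0)

theorem StageMatching.card_untouched_le_of_notMem (hM : StageMatching V W y M)
    (hVW : Disjoint V W) (hv : v ∈ V) (hw : w ∈ W) (hvX : v ∉ untouched m V W M) :
    (untouched m V W M).card ≤ (untouched m V W (acceptEdge M (mkEdge v w y))).card := by
  refine Finset.card_le_card fun u hu => hM.mem_untouched_acceptEdge hVW hv hw hu ?_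
  rintro rfl
  exact hvX hu

/-- How the three quantities that describe a stage change when an edge is accepted. -/
theorem StageMatching.step (hM : StageMatching V W y M) (hVW : Disjoint V W)
    (hkill : ∀ a, 0 < a → (f {y, a} y : ℝ) = 0) (hm : 0 ≤ m.sum) (hv : v ∈ V) (hw : w ∈ W)
    (hends : ∀ g ∈ M, g.ends ≠ (mkEdge v w y).ends)
    (hacc : 0 < (f (conflictW M (mkEdge v w y)) y : ℝ)) :
    touchCount W M ≤ touchCount W (acceptEdge M (mkEdge v w y)) ∧
    (untouched m V W M).card + touchCount W M ≤
      (untouched m V W (acceptEdge M (mkEdge v w y))).card +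
        touchCount W (acceptEdge M (mkEdge v w y)) ∧
    oldWeight W (acceptEdge M (mkEdge v w y)) -
        m.sum * (untouched m V W (acceptEdge M (mkEdge v w y))).card ≤
      oldWeight W M - m.sum * (untouched m V W M).card := by
  have hor := hM.free_or_free hVW hkill hv hw hends hacc
  have hY := hM.touchCount_le hw (v := v) (hor.imp id And.left)
  have hO := oldWeight_acceptEdge_le (v := v) (y := y) hM.pos hw
  refine ⟨hY, ?_⟩
  -- This is the only case in which an untouched vertex can be lost; it is compensated by one more
  -- new edge and by the loss of old weight `m.sum`.
  by_cases hcase : v ∈ untouched m V W M ∧ ∀ g ∈ M, w ∉ g.ends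
  · have h1 := touchCount_acceptEdge_of_untouched (y := y) hcase.1 hw hcase.2
    have h2 := oldWeight_acceptEdge_of_untouched (y := y) hcase.1 hw hcase.2
    have h3 := hM.card_untouched_le hVW hv hw (m := m)
    refine ⟨by omega, ?_⟩
    have h4 : ((untouched m V W M).card : ℝ) ≤
      (untouched m V W (acceptEdge M (mkEdge v w y))).card + 1 := by exact_mod_cast h3
    have := mul_le_mul_of_nonneg_left h4 hm
    rw [h2]
    linarith
  · have h3 : (untouched m V W M).card ≤
        (untouched m V W (acceptEdge M (mkEdge v w y))).card := by
      rcases hor with h | ⟨h, v', hv', hne, hmem⟩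
      · exact hM.card_untouched_le_of_notMem hVW hv hw fun h' => hcase ⟨h', h⟩
      · exact hM.card_untouched_le_of_free hVW hv hw h hv' hne hmem
    refine ⟨by omega, ?_⟩
    have h4 : ((untouched m V W M).card : ℝ) ≤
      (untouched m V W (acceptEdge M (mkEdge v w y))).card := by exact_mod_cast h3
    have := mul_le_mul_of_nonneg_left h4 hm
    linarith

end StageStep

/-! ### Choosing the edges of a stage -/

section StageList

variable {f : Multiset ℝ → ℝ → unitInterval} {σ : List WEdge} {V W : Finset ℕ} {m : Multiset ℝ}
  {y : ℝ} {M : Finset WEdge} {P : List (ℕ × ℕ)} {p : ℕ × ℕ}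

/-- The edges of weight `y` that join the given pairs of vertices. -/
def pairEdges (P : List (ℕ × ℕ)) (y : ℝ) : List WEdge := P.map fun p => mkEdge p.1 p.2 y

/-- Edges of weight `y` between `V` and the new vertices `W` can be presented after `σ`. -/
structure StageSetup (f : Multiset ℝ → ℝ → unitInterval) (σ : List WEdge) (V W : Finset ℕ)
    (m : Multiset ℝ) (y : ℝ) : Prop where
  isInstance : IsInstance σ
  eq_of_mem : ∀ g ∈ σ, ∀ v ∈ V, ∀ v' ∈ V, v ∈ g.ends → v' ∈ g.ends → v = v'
  fresh : ∀ g ∈ σ, ∀ w ∈ W, w ∉ g.ends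
  disjoint : Disjoint V W
  pos : 0 < y
  kill : ∀ a, 0 < a → (f {y, a} y : ℝ) = 0
  sum_nonneg : 0 ≤ m.sum

/-- A list of distinct pairs in `V × W`. -/
def IsPairList (V W : Finset ℕ) (P : List (ℕ × ℕ)) : Prop := P.Nodup ∧ ∀ p ∈ P, p ∈ V ×ˢ W

theorem IsPairList.of_concat (h : IsPairList V W (P ++ [p])) :
    IsPairList V W P ∧ p ∉ P ∧ p.1 ∈ V ∧ p.2 ∈ W := by
  obtain ⟨h1, h2⟩ := h
  rw [List.nodup_append] at h1
  refine ⟨⟨h1.1, fun q hq => h2 q (by simp [hq])⟩, fun hp => h1.2.2 p hp p (by simp) rfl, ?_⟩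
  exact Finset.mem_product.1 (h2 p (by simp))

theorem IsPairList.concat (h : IsPairList V W P) (hp : p ∈ V ×ˢ W) (hpP : p ∉ P) :
    IsPairList V W (P ++ [p]) := by
  refine ⟨List.nodup_append.2 ⟨h.1, by simp, ?_⟩, ?_⟩
  · rintro a ha b hb rfl
    rw [List.mem_singleton] at hb
    exact hpP (hb ▸ ha)
  · intro q hq
    rcases List.mem_append.1 hq with hq | hq
    · exact h.2 q hq
    · rw [List.mem_singleton] at hq
      exact hq ▸ hp

theorem mkEdge_ends_inj (hVW : Disjoint V W) {v v' w w' : ℕ} {x x' : ℝ} (hv : v ∈ V) (hw' : w' ∈ W)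
    (h : (mkEdge v w x).ends = (mkEdge v' w' x').ends) : v = v' ∧ w = w' := by
  simp only [mkEdge, Sym2.eq_iff] at h
  rcases h with h | h
  · exact h
  · exact absurd (h.1 ▸ hw') (Finset.disjoint_left.1 hVW hv)

theorem StageSetup.isInstance_append (h : StageSetup f σ V W m y) (hP : IsPairList V W P) :
    IsInstance (σ ++ pairEdges P y) := by
  refine _root_.isInstance_append h.isInstance ⟨?_, ?_⟩ ?_
  · intro e he
    obtain ⟨q, hq, rfl⟩ := List.mem_map.1 he
    have := Finset.mem_product.1 (hP.2 q hq)
    refine ⟨?_, h.pos⟩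
    simp only [mkEdge, Sym2.mk_isDiag_iff]
    intro heq
    exact Finset.disjoint_left.1 h.disjoint this.1 (heq ▸ this.2)
  · unfold pairEdges
    rw [List.map_map]
    refine hP.1.map_on fun q hq r hr heq => ?_
    have h1 := Finset.mem_product.1 (hP.2 q hq)
    have h2 := Finset.mem_product.1 (hP.2 r hr)
    have := mkEdge_ends_inj h.disjoint h1.1 h2.2 heq
    exact Prod.ext this.1 this.2
  · intro e he g hg heq
    obtain ⟨q, hq, rfl⟩ := List.mem_map.1 he
    have := Finset.mem_product.1 (hP.2 q hq)
    exact h.fresh g hg _ this.2 (heq ▸ by simp)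

theorem StageSetup.stageMatching (h : StageSetup f σ V W m y) (hP : IsPairList V W P)
    (hM : Reach f ∅ (σ ++ pairEdges P y) M) : StageMatching V W y M where
  isMatching := hM.isMatching isMatching_empty
  pos g hg := ((h.isInstance_append hP).1 g (hM.mem hg)).2
  eq_of_mem g hg v hv v' hv' hvg hvg' := by
    rcases List.mem_append.1 (hM.mem hg) with h1 | h1
    · exact h.eq_of_mem g h1 v hv v' hv' hvg hvg'
    · obtain ⟨q, hq, rfl⟩ := List.mem_map.1 h1
      have hq2 := (Finset.mem_product.1 (hP.2 q hq)).2
      have key : ∀ t ∈ V, t ∈ (mkEdge q.1 q.2 y).ends → t = q.1 := by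
        intro t ht ht'
        rcases mem_ends_mkEdge.1 ht' with rfl | rfl
        · rfl
        · exact absurd hq2 (Finset.disjoint_left.1 h.disjoint ht)
      rw [key v hv hvg, key v' hv' hvg']
  new g hg ht := by
    rcases List.mem_append.1 (hM.mem hg) with h1 | h1
    · obtain ⟨w, hw, hwg⟩ := ht
      exact absurd hwg (h.fresh g h1 w hw)
    · obtain ⟨q, hq, rfl⟩ := List.mem_map.1 h1
      have hq2 := Finset.mem_product.1 (hP.2 q hq)
      exact ⟨q.1, hq2.1, q.2, hq2.2, rfl⟩

theorem StageSetup.ends_ne (h : StageSetup f σ V W m y) (hP : IsPairList V W P)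
    (hM : Reach f ∅ (σ ++ pairEdges P y) M) (hp : p ∉ P) (hp2 : p.2 ∈ W) :
    ∀ g ∈ M, g.ends ≠ (mkEdge p.1 p.2 y).ends := by
  intro g hg heq
  rcases List.mem_append.1 (hM.mem hg) with h1 | h1
  · exact h.fresh g h1 p.2 hp2 (heq ▸ by simp)
  · obtain ⟨q, hq, rfl⟩ := List.mem_map.1 h1
    have hq2 := Finset.mem_product.1 (hP.2 q hq)
    have := mkEdge_ends_inj h.disjoint hq2.1 hp2 heq
    exact hp (Prod.ext this.1 this.2 ▸ hq)

theorem pairEdges_concat : pairEdges (P ++ [p]) y = pairEdges P y ++ [mkEdge p.1 p.2 y] := by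
  simp [pairEdges]

/-- A quantity that no accepted edge decreases does not decrease in expectation. -/
theorem StageSetup.expect_le (h : StageSetup f σ V W m y) {F : Finset WEdge → ℝ}
    (hF : ∀ M, StageMatching V W y M → ∀ v ∈ V, ∀ w ∈ W,
      (∀ g ∈ M, g.ends ≠ (mkEdge v w y).ends) →
      0 < (f (conflictW M (mkEdge v w y)) y : ℝ) → F M ≤ F (acceptEdge M (mkEdge v w y)))
    (hP : IsPairList V W P) : expect f ∅ σ F ≤ expect f ∅ (σ ++ pairEdges P y) F := by
  induction P using List.reverseRecOn with
  | nil => simp [pairEdges]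
  | append_singleton P p ih =>
    obtain ⟨hP', hp, hp1, hp2⟩ := hP.of_concat
    refine (ih hP').trans ?_
    rw [pairEdges_concat, ← List.append_assoc, expect_concat]
    refine expect_mono fun M hM => ?_
    rcases (f (conflictW M (mkEdge p.1 p.2 y)) (mkEdge p.1 p.2 y).weight).2.1.eq_or_lt with h0 | h0
    · rw [← h0]; simp
    · have := hF M (h.stageMatching hP' hM) _ hp1 _ hp2 (h.ends_ne hP' hM hp hp2) h0
      have := mul_nonneg h0.le (sub_nonneg.2 this)
      linarith

open scoped Classical in
/-- The indicator of the event that `p.1` is untouched and `p.2` is not covered. -/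
def readyInd (m : Multiset ℝ) (V W : Finset ℕ) (p : ℕ × ℕ) (M : Finset WEdge) : ℝ :=
  if p.1 ∈ untouched m V W M ∧ ∀ g ∈ M, p.2 ∉ g.ends then 1 else 0

/-- On the ready event the conflicting weights are exactly `m`, so a new edge is gained with
probability `f m y`; otherwise the count does not drop. -/
theorem StageSetup.expect_touchCount_concat (h : StageSetup f σ V W m y)
    (hP : IsPairList V W (P ++ [p])) :
    expect f ∅ (σ ++ pairEdges P y) (fun M => touchCount W M) +
      (f m y : ℝ) * expect f ∅ (σ ++ pairEdges P y) (readyInd m V W p) ≤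
    expect f ∅ (σ ++ pairEdges (P ++ [p]) y) (fun M => touchCount W M) := by
  obtain ⟨hP', hp, hp1, hp2⟩ := hP.of_concat
  rw [pairEdges_concat, ← List.append_assoc, expect_concat, ← expect_const_mul, ← expect_add]
  refine expect_mono fun M hM => ?_
  rw [add_le_add_iff_left]
  by_cases hr : p.1 ∈ untouched m V W M ∧ ∀ g ∈ M, p.2 ∉ g.ends
  · rw [touchCount_acceptEdge_of_untouched hr.1 hp2 hr.2, conflictW_of_free_right hr.2,
      (mem_untouched.1 hr.1).2.1, show readyInd m V W p M = 1 from if_pos hr]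
    simp
  · have hz : readyInd m V W p M = 0 := by
      unfold readyInd
      rw [if_neg hr]
    rw [hz, mul_zero]
    rcases (f (conflictW M (mkEdge p.1 p.2 y)) (mkEdge p.1 p.2 y).weight).2.1.eq_or_lt with h0 | h0
    · rw [← h0]; simp
    · refine mul_nonneg h0.le (sub_nonneg.2 ?_)
      exact_mod_cast ((h.stageMatching hP' hM).step h.disjoint h.kill h.sum_nonneg hp1 hp2
        (h.ends_ne hP' hM hp hp2) h0).1

theorem StageMatching.card_untouched_add_le (hM : StageMatching V W y M) :
    (untouched m V W M).card + touchCount W M ≤ V.card := by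
  classical
  rw [← hM.card_left, ← Finset.card_union_of_disjoint]
  · refine Finset.card_le_card (Finset.union_subset ?_ (Finset.filter_subset _ _))
    exact fun v hv => (mem_untouched.1 hv).1
  · rw [Finset.disjoint_left]
    intro v hv hv'
    rw [Finset.mem_filter] at hv'
    obtain ⟨_, g, hg, hgW, hvg⟩ := hv'
    exact (mem_untouched.1 hv).2.2 g hg hvg hgW

theorem StageMatching.sum_readyInd (hM : StageMatching V W y M) (hVW : Disjoint V W) :
    ∑ p ∈ V ×ˢ W, readyInd m V W p M =
      (untouched m V W M).card * ((W.card : ℝ) - touchCount W M) := by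
  classical
  unfold readyInd
  rw [Finset.sum_boole]
  have h1 : (V ×ˢ W).filter (fun p => p.1 ∈ untouched m V W M ∧ ∀ g ∈ M, p.2 ∉ g.ends) =
      untouched m V W M ×ˢ W.filter fun w => ¬ ∃ g ∈ M, w ∈ g.ends := by
    ext ⟨v, w⟩
    simp only [Finset.mem_filter, Finset.mem_product, not_exists, not_and]
    constructor
    · rintro ⟨⟨_, hw⟩, h2, h3⟩
      exact ⟨h2, hw, h3⟩
    · rintro ⟨h2, hw, h3⟩
      exact ⟨⟨(mem_untouched.1 h2).1, hw⟩, h2, h3⟩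
  rw [h1, Finset.card_product, ← hM.card_right hVW,
    ← Finset.card_filter_add_card_filter_not (s := W) (fun w => ∃ g ∈ M, w ∈ g.ends)]
  push_cast
  ring

theorem StageSetup.untouched_card (h : StageSetup f σ V W m y) (hM : Reach f ∅ σ M) :
    ((untouched m V W M).card : ℝ) = V.card - (deviating m V M).card := by
  classical
  have h1 : untouched m V W M = V.filter fun v => weightsAt M v = m := by
    ext v
    rw [mem_untouched, Finset.mem_filter]
    refine ⟨fun hv => ⟨hv.1, hv.2.1⟩, fun hv => ⟨hv.1, hv.2, ?_⟩⟩
    rintro g hg _ ⟨w, hw, hwg⟩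
    exact h.fresh g (hM.mem hg) w hw hwg
  rw [eq_sub_iff_add_eq, h1, deviating]
  exact_mod_cast Finset.card_filter_add_card_filter_not _

/-- Before the stage nothing meets `W`, so untouched means not deviating; afterwards untouched plus
touched never decreases when an edge is accepted. -/
theorem StageSetup.card_sub_le_expect (h : StageSetup f σ V W m y) (hP : IsPairList V W P) :
    (V.card : ℝ) - expect f ∅ σ (fun M => (deviating m V M).card) ≤
      expect f ∅ (σ ++ pairEdges P y)
        (fun M => (untouched m V W M).card + (touchCount W M : ℝ)) := by
  refine le_trans ?_ (h.expect_le (fun M hM v hv w hw he hacc => ?_) hP)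
  · rw [← expect_const (f := f) ∅ σ (V.card : ℝ), ← expect_sub]
    refine expect_mono fun M hM => ?_
    rw [h.untouched_card hM]
    linarith [Nat.cast_nonneg (α := ℝ) (touchCount W M)]
  · exact_mod_cast (hM.step h.disjoint h.kill h.sum_nonneg hv hw he hacc).2.1

/-- With `X` untouched vertices, `Y` new edges and `D = n - Y`, there are `X * D ≥ D ^ 2 - n * (n -
X - Y)` ready pairs. The square is bounded below by its tangent at `d * n`, in place of Jensen's
inequality, leaving only expectations that are controlled. -/
theorem StageSetup.le_expect_sum_readyInd (h : StageSetup f σ V W m y) (hP : IsPairList V W P)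
    {n : ℕ} (hV : V.card = n) (hW : W.card = n) {d e : ℝ} (hd : 0 ≤ d)
    (hdev : expect f ∅ σ (fun M => (deviating m V M).card) ≤ e * n)
    (hD : d * n ≤ expect f ∅ (σ ++ pairEdges P y) (fun M => (n : ℝ) - touchCount W M)) :
    (d ^ 2 - e) * n ^ 2 ≤
      ∑ p ∈ V ×ˢ W, expect f ∅ (σ ++ pairEdges P y) (readyInd m V W p) := by
  rw [← expect_sum]
  have h1 := h.card_sub_le_expect hP
  rw [hV] at h1
  have h2 : expect f ∅ (σ ++ pairEdges P y) (fun M => 2 * d * n * ((n : ℝ) - touchCount W M) +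
      (-(d ^ 2 * n ^ 2 + n ^ 2) +
        n * ((untouched m V W M).card + (touchCount W M : ℝ)))) ≤
      expect f ∅ (σ ++ pairEdges P y) (fun M => ∑ p ∈ V ×ˢ W, readyInd m V W p M) := by
    refine expect_mono fun M hM => ?_
    have hS := h.stageMatching hP hM
    rw [hS.sum_readyInd h.disjoint, hW]
    have h3 : ((untouched m V W M).card : ℝ) + touchCount W M ≤ n := by
      rw [← hV]
      exact_mod_cast hS.card_untouched_add_le
    have h4 : (0 : ℝ) ≤ touchCount W M := Nat.cast_nonneg _
    nlinarith [mul_nonneg h4 (sub_nonneg.2 h3), sq_nonneg ((n : ℝ) - touchCount W M - d * n)]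
  rw [expect_add, expect_add, expect_const_mul, expect_const_mul, expect_const] at h2
  have hn : (0 : ℝ) ≤ n := Nat.cast_nonneg _
  have h5 := mul_le_mul_of_nonneg_left hD (by positivity : 0 ≤ 2 * d * n)
  have h6 := mul_le_mul_of_nonneg_left (le_trans (sub_le_sub_left hdev _) h1) hn
  refine le_trans ?_ h2
  nlinarith

/-- Suitably chosen edges between `V` and `W` lead to an almost perfect matching of `V` and `W`. -/
theorem StageSetup.exists_pairList (h : StageSetup f σ V W m y) {n : ℕ} (hV : V.card = n)
    (hW : W.card = n) (hacc : 0 < (f m y : ℝ)) {d e : ℝ} (hd : 0 < d) (he : e ≤ d ^ 2 / 4)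
    (hdev : expect f ∅ σ (fun M => (deviating m V M).card) ≤ e * n) (hn1 : 1 ≤ n)
    (hn : 4 * (2 / ((f m y : ℝ) * d ^ 2) + 1) / d ^ 2 ≤ n) :
    ∃ P, IsPairList V W P ∧
      expect f ∅ (σ ++ pairEdges P y) (fun M => (n : ℝ) - touchCount W M) ≤ d * n := by
  by_contra hcon
  push Not at hcon
  set a : ℝ := ((f m y : unitInterval) : ℝ) with ha
  -- The gain per chosen pair: acceptance probability `a` times readiness at least `d ^ 2 / 2`.
  set k : ℝ := a * d ^ 2 / 2 with hk
  have hk0 : 0 < k := by positivity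
  have hn1' : (1 : ℝ) ≤ n := by exact_mod_cast hn1
  have hT : (n : ℝ) / k + 1 ≤ d ^ 2 * n ^ 2 / 4 := by
    rw [div_le_iff₀ (by positivity)] at hn
    have h1 : (2 : ℝ) / (a * d ^ 2) = 1 / k := by
      rw [hk]
      field_simp
    rw [h1] at hn
    have h2 : (n : ℝ) / k = n * (1 / k) := by ring
    rw [h2]
    nlinarith
  -- Greedy choice: as long as the goal is missed, some unused pair is ready with probability at
  -- least `d ^ 2 / 2`. Of the average `d ^ 2`, the initial deviation and the used pairs each cost
  -- at most `d ^ 2 / 4`.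
  have key : ∀ t : ℕ, (t : ℝ) ≤ n / k + 1 → ∃ P, IsPairList V W P ∧ P.length = t ∧
      t * k ≤ expect f ∅ (σ ++ pairEdges P y) (fun M => touchCount W M) := by
    intro t
    induction t with
    | zero =>
      intro _
      refine ⟨[], ⟨by simp, by simp⟩, rfl, ?_⟩
      rw [Nat.cast_zero, zero_mul, ← expect_const (f := f) ∅ (σ ++ pairEdges [] y) 0]
      exact expect_mono fun M _ => Nat.cast_nonneg _
    | succ t ih =>
      intro ht
      push_cast at ht
      obtain ⟨P, hP, hlen, hE⟩ := ih (by linarith)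
      have hsum := h.le_expect_sum_readyInd hP hV hW hd.le hdev (hcon P hP).le
      obtain ⟨p, hp, hpP, hpE⟩ : ∃ p ∈ V ×ˢ W, p ∉ P ∧
          d ^ 2 / 2 ≤ expect f ∅ (σ ++ pairEdges P y) (readyInd m V W p) := by
        by_contra hno
        push Not at hno
        have h1 : ∑ p ∈ V ×ˢ W, expect f ∅ (σ ++ pairEdges P y) (readyInd m V W p) ≤
            ∑ p ∈ V ×ˢ W, (d ^ 2 / 2 + if p ∈ P then 1 else 0) := by
          refine Finset.sum_le_sum fun p hp => ?_
          split_ifs with hpP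
          · have : expect f ∅ (σ ++ pairEdges P y) (readyInd m V W p) ≤ 1 := by
              rw [← expect_const (f := f) ∅ (σ ++ pairEdges P y) 1]
              refine expect_mono fun M _ => ?_
              unfold readyInd
              split_ifs <;> norm_num
            have : 0 ≤ d ^ 2 / 2 := by positivity
            linarith
          · rw [add_zero]
            exact (hno p hp hpP).le
        rw [Finset.sum_add_distrib, Finset.sum_const, Finset.card_product, hV, hW,
          Finset.sum_boole] at h1
        have h2 : (((V ×ˢ W).filter fun p => p ∈ P).card : ℝ) ≤ t := by
          rw [← hlen, ← List.toFinset_card_of_nodup hP.1]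
          exact_mod_cast Finset.card_le_card fun p hp => by
            simpa using (Finset.mem_filter.1 hp).2
        rw [nsmul_eq_mul] at h1
        push_cast at h1
        have h3 : e * n ^ 2 ≤ d ^ 2 / 4 * n ^ 2 := by gcongr
        nlinarith
      refine ⟨P ++ [p], hP.concat hp hpP, by simp [hlen], ?_⟩
      have h1 := h.expect_touchCount_concat (hP.concat hp hpP)
      have h2 := mul_le_mul_of_nonneg_left hpE hacc.le
      push_cast
      have h3 : a * (d ^ 2 / 2) = k := by rw [hk]; ring
      rw [← ha] at h1
      rw [h3] at h2
      linarith
  -- One step beyond `n / k` would force an expected number of new edges above `n`.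
  obtain ⟨P, hP, _, hE⟩ := key (⌊(n : ℝ) / k⌋₊ + 1) (by
    push_cast
    have := Nat.floor_le (by positivity : 0 ≤ (n : ℝ) / k)
    linarith)
  have h1 := Nat.lt_floor_add_one ((n : ℝ) / k)
  rw [div_lt_iff₀ hk0] at h1
  have h2 := hcon P hP
  rw [expect_sub, expect_const] at h2
  push_cast at hE
  have : 0 < d * n := by positivity
  linarith

end StageList

/-! ### Pendant edges appended to an input -/

section PendantStage

variable {f : Multiset ℝ → ℝ → unitInterval} {σ : List WEdge} {U V : Finset ℕ} {m : Multiset ℝ}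
  {z : ℝ} {b : ℕ} {N : Finset WEdge}

/-- Edges of weight `z` that join the vertices of `U` to new vertices. -/
def pendants (b : ℕ) (z : ℝ) (U : Finset ℕ) : List WEdge :=
  U.toList.map fun u => mkEdge u (b + u) z

theorem mem_pendants {g : WEdge} : g ∈ pendants b z U ↔ ∃ u ∈ U, mkEdge u (b + u) z = g := by
  simp [pendants]

theorem pendant_eq_of_mem (hU : ∀ u ∈ U, u < b) {u u' t : ℕ} (hu : u ∈ U) (hu' : u' ∈ U)
    (h : t ∈ (mkEdge u (b + u) z).ends) (h' : t ∈ (mkEdge u' (b + u') z).ends) : u = u' := by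
  have h1 := hU u hu
  have h2 := hU u' hu'
  rw [mem_ends_mkEdge] at h h'
  omega

theorem isInstance_append_pendants (hσ : IsInstance σ) (hB : ∀ g ∈ σ, ∀ v ∈ g.ends, v < b)
    (hU : ∀ u ∈ U, u < b) (hz : 0 < z) : IsInstance (σ ++ pendants b z U) := by
  refine isInstance_append hσ ⟨?_, ?_⟩ ?_
  · intro e he
    obtain ⟨u, hu, rfl⟩ := mem_pendants.1 he
    refine ⟨?_, hz⟩
    have := hU u hu
    simp only [mkEdge, Sym2.mk_isDiag_iff]
    omega
  · unfold pendants
    rw [List.map_map]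
    refine U.nodup_toList.map_on fun u hu u' hu' heq => ?_
    rw [Finset.mem_toList] at hu hu'
    have h1 : u ∈ (mkEdge u' (b + u') z).ends := by
      have h2 : (mkEdge u (b + u) z).ends = (mkEdge u' (b + u') z).ends := heq
      rw [← h2]
      simp
    exact pendant_eq_of_mem (z := z) hU hu hu' (by simp) h1
  · intro e he g hg heq
    obtain ⟨u, hu, rfl⟩ := mem_pendants.1 he
    have := hB g hg (b + u) (heq ▸ by simp)
    omega

open scoped Classical in
theorem isMatching_union_pendants (hN : IsMatching N) (hB : ∀ g ∈ N, ∀ v ∈ g.ends, v < b)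
    (hU : ∀ u ∈ U, u < b) (hNU : ∀ g ∈ N, ∀ u ∈ U, u ∉ g.ends) :
    IsMatching (N ∪ (pendants b z U).toFinset) := by
  have key : ∀ g ∈ N, ∀ u ∈ U, ¬ (mkEdge u (b + u) z).Conflicts g := by
    intro g hg u hu hc
    rcases mkEdge_conflicts.1 hc with h | h
    · exact hNU g hg u hu h
    · have := hB g hg _ h
      omega
  intro g hg g' hg' hne
  rw [Finset.mem_coe, Finset.mem_union, List.mem_toFinset, mem_pendants] at hg hg'
  rcases hg with hg | ⟨u, hu, rfl⟩ <;> rcases hg' with hg' | ⟨u', hu', rfl⟩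
  · exact hN hg hg' hne
  · exact fun h => key g hg u' hu' h.symm
  · exact key g' hg' u hu
  · rintro ⟨t, ht, ht'⟩
    exact hne (by rw [pendant_eq_of_mem hU hu hu' ht ht'])

open scoped Classical in
theorem totalWeight_union_pendants (hU : ∀ u ∈ U, u < b) (hNU : ∀ g ∈ N, ∀ u ∈ U, u ∉ g.ends) :
    totalWeight (N ∪ (pendants b z U).toFinset) = totalWeight N + z * U.card := by
  unfold totalWeight
  rw [Finset.sum_union]
  · have h1 : (pendants b z U).toFinset = U.image fun u => mkEdge u (b + u) z := by
      ext g
      rw [List.mem_toFinset, mem_pendants, Finset.mem_image]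
    rw [h1, Finset.sum_image]
    · simp [mul_comm]
    · intro u hu u' hu' heq
      have heq' : mkEdge u (b + u) z = mkEdge u' (b + u') z := heq
      exact pendant_eq_of_mem (z := z) (t := u) hU hu hu' (by simp) (by rw [← heq']; simp)
  · rw [Finset.disjoint_left]
    intro g hg hg'
    rw [List.mem_toFinset, mem_pendants] at hg'
    obtain ⟨u, hu, rfl⟩ := hg'
    exact hNU _ hg u hu (by simp)

theorem expect_totalWeight_append_pendants_le (hσ : IsInstance σ)
    (hB : ∀ g ∈ σ, ∀ v ∈ g.ends, v < b) (hU : ∀ u ∈ U, u < b) (hz : 0 ≤ z)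
    (hfz : (f m z : ℝ) = 0) :
    expect f ∅ (σ ++ pendants b z U) totalWeight ≤
      expect f ∅ σ totalWeight + z * expect f ∅ σ (fun M => (deviating m U M).card) := by
  rw [expect_append, ← expect_const_mul, ← expect_add]
  refine expect_mono fun M hM => ?_
  have := expect_totalWeight_pendants_le (hM.isMatching isMatching_empty)
    (fun g hg => (hσ.1 g (hM.mem hg)).2.le) (b := b) hz hfz (l := U.toList)
    (fun v hv => hU v (Finset.mem_toList.1 hv)) U.nodup_toList fun g hg v _ h => by
      have := hB g (hM.mem hg) _ h
      omega
  rwa [Finset.toList_toFinset] at this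

theorem expect_deviating_append_pendants_le (hB : ∀ g ∈ σ, ∀ v ∈ g.ends, v < b)
    (hU : ∀ u ∈ U, u < b) (hV : ∀ v ∈ V, v < b) (hfz : (f m z : ℝ) = 0) :
    expect f ∅ (σ ++ pendants b z U) (fun M => (deviating m V M).card) ≤
      expect f ∅ σ (fun M => (deviating m V M).card) := by
  rw [expect_append]
  refine expect_mono fun M hM => ?_
  rw [← expect_const (f := f) M (pendants b z U) ((deviating m V M).card : ℝ)]
  refine expect_mono fun M' hM' => ?_
  have : deviating m V M' ⊆ deviating m V M := by
    intro v hv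
    rw [mem_deviating] at hv ⊢
    refine ⟨hv.1, fun h => hv.2 ?_⟩
    refine hM'.weightsAt_pendants (hM.isMatching isMatching_empty) hfz
      (fun v hv => hU v (Finset.mem_toList.1 hv)) U.nodup_toList (fun g hg v _ h => ?_)
      (hV v hv.1) h
    have := hB g (hM.mem hg) _ h
    omega
  exact_mod_cast Finset.card_le_card this

end PendantStage

/-! ### One round: pendants, then a stage -/

section Induction

variable {f : Multiset ℝ → ℝ → unitInterval} {c : ℝ} {m : Multiset ℝ} {r y z : ℝ}

/-- There are inputs after which almost all vertices of a set `V` of `n` vertices see the weights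
`m`, the expected weight is hardly more than `n * m.sum`, and a matching that avoids `V` has weight at
least `r * n`. -/
def HalfPrepared (f : Multiset ℝ → ℝ → unitInterval) (m : Multiset ℝ) (r : ℝ) : Prop :=
  ∀ ε : ℝ, 0 < ε → ∀ n₀ : ℕ, ∃ n ≥ n₀, ∃ (σ : List WEdge) (V : Finset ℕ) (N : Finset WEdge),
    IsInstance σ ∧ V.card = n ∧
    (∀ g ∈ σ, ∀ v ∈ V, ∀ v' ∈ V, v ∈ g.ends → v' ∈ g.ends → v = v') ∧
    expect f ∅ σ totalWeight ≤ (m.sum + ε) * n ∧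
    expect f ∅ σ (fun M => (deviating m V M).card) ≤ ε * n ∧
    (∀ g ∈ N, g ∈ σ) ∧ IsMatching N ∧ (∀ g ∈ N, ∀ v ∈ V, v ∉ g.ends) ∧ r * n ≤ totalWeight N

/-- Like `HalfPrepared`, with two sets of `n` vertices in place of one. -/
def Prepared (f : Multiset ℝ → ℝ → unitInterval) (m : Multiset ℝ) (r : ℝ) : Prop :=
  ∀ ε : ℝ, 0 < ε → ∀ n₀ : ℕ, ∃ n ≥ n₀, ∃ (σ : List WEdge) (U V : Finset ℕ) (N : Finset WEdge),
    IsInstance σ ∧ U.card = n ∧ V.card = n ∧ Disjoint U V ∧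
    (∀ g ∈ σ, ∀ v ∈ V, ∀ v' ∈ V, v ∈ g.ends → v' ∈ g.ends → v = v') ∧
    expect f ∅ σ totalWeight ≤ (m.sum + ε) * n ∧
    expect f ∅ σ (fun M => (deviating m U M).card) ≤ ε * n ∧
    expect f ∅ σ (fun M => (deviating m V M).card) ≤ ε * n ∧
    (∀ g ∈ N, g ∈ σ) ∧ IsMatching N ∧ (∀ g ∈ N, ∀ u ∈ U, u ∉ g.ends) ∧
    (∀ g ∈ N, ∀ v ∈ V, v ∉ g.ends) ∧ r * n ≤ totalWeight N

theorem exists_common_bound (σ : List WEdge) (S : Finset ℕ) :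
    ∃ b : ℕ, (∀ g ∈ σ, ∀ v ∈ g.ends, v < b) ∧ ∀ v ∈ S, v < b := by
  obtain ⟨B, hB⟩ := exists_vertex_bound σ
  refine ⟨B + (S.sup id + 1), fun g hg v hv => ?_, fun v hv => ?_⟩
  · have := hB g hg v hv
    omega
  · have : v ≤ S.sup id := Finset.le_sup (f := id) hv
    omega

theorem halfPrepared_zero (f : Multiset ℝ → ℝ → unitInterval) : HalfPrepared f 0 0 := by
  intro ε hε n₀
  refine ⟨n₀, le_rfl, [], Finset.range n₀, ∅, isInstance_nil, by simp, by simp, ?_, ?_, by simp,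
    isMatching_empty, by simp, by simp [totalWeight]⟩
  · simp only [expect, totalWeight, Finset.sum_empty, Multiset.sum_zero, zero_add]
    positivity
  · have : deviating 0 (Finset.range n₀) ∅ = ∅ := by
      simp [deviating, weightsAt]
    simp only [expect, this, Finset.card_empty, Nat.cast_zero]
    positivity

/-- The set `U` is spent: its pendants enlarge the offline matching by `z * n`, while the algorithm
gains almost nothing and `V` keeps seeing `m`. -/
theorem Prepared.pendant (h : Prepared f m r) (hz : 0 < z) (hfz : (f m z : ℝ) = 0) :
    HalfPrepared f m (r + z) := by
  classical
  intro ε hε n₀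
  obtain ⟨n, hn, σ, U, V, N, hσ, hU, hV, hUV, hin, hE, hdU, hdV, hNσ, hN, hNU, hNV, hr⟩ :=
    h (ε / (1 + z)) (by positivity) n₀
  obtain ⟨b, hB, hb⟩ := exists_common_bound σ (U ∪ V)
  have hbU : ∀ u ∈ U, u < b := fun u hu => hb u (Finset.mem_union_left _ hu)
  have hbV : ∀ v ∈ V, v < b := fun v hv => hb v (Finset.mem_union_right _ hv)
  have hoff : ∀ g ∈ pendants b z U, ∀ v ∈ V, v ∉ g.ends := by
    intro g hg v hv hvg
    obtain ⟨u, hu, rfl⟩ := mem_pendants.1 hg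
    rcases mem_ends_mkEdge.1 hvg with rfl | rfl
    · exact Finset.disjoint_left.1 hUV hu hv
    · have := hbV _ hv
      omega
  have hε' : ε / (1 + z) ≤ ε := div_le_self hε.le (by linarith)
  have hn0 : (0 : ℝ) ≤ n := Nat.cast_nonneg _
  refine ⟨n, hn, σ ++ pendants b z U, V, N ∪ (pendants b z U).toFinset,
    isInstance_append_pendants hσ hB hbU hz, hV, ?_, ?_, ?_, ?_,
    isMatching_union_pendants hN (fun g hg => hB g (hNσ g hg)) hbU hNU, ?_, ?_⟩
  · intro g hg v hv v' hv' hvg hvg'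
    rcases List.mem_append.1 hg with hg | hg
    · exact hin g hg v hv v' hv' hvg hvg'
    · exact absurd hvg (hoff g hg v hv)
  · refine (expect_totalWeight_append_pendants_le hσ hB hbU hz.le hfz).trans ?_
    have h1 := mul_le_mul_of_nonneg_left hdU hz.le
    have h2 : ε / (1 + z) * (1 + z) = ε := by field_simp
    calc _ ≤ (m.sum + ε / (1 + z)) * n + z * (ε / (1 + z) * n) := add_le_add hE h1
      _ = (m.sum + ε / (1 + z) * (1 + z)) * n := by ring
      _ = _ := by rw [h2]
  · refine (expect_deviating_append_pendants_le hB hbU hbV hfz).trans (hdV.trans ?_)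
    gcongr
  · intro g hg
    rcases Finset.mem_union.1 hg with hg | hg
    · exact List.mem_append_left _ (hNσ g hg)
    · exact List.mem_append_right _ (List.mem_toFinset.1 hg)
  · intro g hg
    rcases Finset.mem_union.1 hg with hg | hg
    · exact hNV g hg
    · exact hoff g (List.mem_toFinset.1 hg)
  · rw [totalWeight_union_pendants hbU hNU, hU]
    linarith

/-- Pendants at `V` end the game with an offline matching of weight at least `(r + z) * n` against
hardly more than `m.sum * n`. -/
theorem LocalCompetitive.add_le (hf : LocalCompetitive f c) (h : HalfPrepared f m r) (hz : 0 < z)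
    (hfz : (f m z : ℝ) = 0) : r + z ≤ c * m.sum := by
  classical
  refine le_of_forall_pos_le_add fun ε hε => ?_
  have hc := hf.1
  obtain ⟨n, hn, σ, V, N, hσ, hV, hin, hE, hdV, hNσ, hN, hNV, hr⟩ :=
    h (ε / (c * (1 + z))) (by positivity) 1
  obtain ⟨b, hB, hb⟩ := exists_common_bound σ V
  have h1 := hf.2 _ (isInstance_append_pendants hσ hB hb hz) (N ∪ (pendants b z V).toFinset) (by
    intro g hg
    rcases Finset.mem_union.1 hg with hg | hg
    · exact List.mem_append_left _ (hNσ g hg)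
    · exact List.mem_append_right _ (List.mem_toFinset.1 hg))
    (isMatching_union_pendants hN (fun g hg => hB g (hNσ g hg)) hb hNV)
  rw [totalWeight_union_pendants hb hNV, hV] at h1
  have h2 := expect_totalWeight_append_pendants_le hσ hB hb hz.le hfz
  have h3 := mul_le_mul_of_nonneg_left hdV hz.le
  have h4 : c * (ε / (c * (1 + z)) * (1 + z)) = ε := by field_simp
  have h5 : c * expect f ∅ (σ ++ pendants b z V) totalWeight ≤ (c * m.sum + ε) * n := by
    calc _ ≤ c * ((m.sum + ε / (c * (1 + z))) * n + z * (ε / (c * (1 + z)) * n)) := by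
          gcongr
          linarith
      _ = (c * m.sum + c * (ε / (c * (1 + z)) * (1 + z))) * n := by ring
      _ = _ := by rw [h4]
  have hn0 : (0 : ℝ) < n := by exact_mod_cast hn
  refine le_of_mul_le_mul_right ?_ hn0
  linarith

/-- The vertices of `V` trade the weights `m` for `y`-edges into `W`. Both sides of the resulting
almost perfect matching then see `{y}`, and the offline matching is untouched. -/
theorem HalfPrepared.stage (h : HalfPrepared f m r) (hm : 0 ≤ m.sum) (hy : 0 < y)
    (hkill : ∀ a, 0 < a → (f {y, a} y : ℝ) = 0) (hacc : 0 < (f m y : ℝ)) :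
    Prepared f {y} r := by
  classical
  intro ε hε n₀
  -- With `e ≤ d`, the final weight error `e + m.sum * e + m.sum * d` is at most `2 * d * (1 +
  -- m.sum) = ε / 2`.
  set d : ℝ := ε / (4 * (1 + m.sum)) with hd
  have hd0 : 0 < d := by positivity
  have hdm : d * (1 + m.sum) = ε / 4 := by rw [hd]; field_simp
  have hdε : d ≤ ε / 4 := by nlinarith
  set e : ℝ := min (d ^ 2 / 4) d with he
  have he0 : 0 < e := by positivity
  have hed : e ≤ d := min_le_right _ _
  obtain ⟨n₁, hn₁⟩ := exists_nat_ge (4 * (2 / ((f m y : ℝ) * d ^ 2) + 1) / d ^ 2)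
  obtain ⟨n, hn, σ, V, N, hσ, hV, hin, hE, hdV, hNσ, hN, hNV, hr⟩ :=
    h e he0 (n₀ + n₁ + 1)
  obtain ⟨b, hB, hb⟩ := exists_common_bound σ V
  set W : Finset ℕ := Finset.Ico b (b + n) with hW
  have hbW : ∀ w ∈ W, b ≤ w := fun w hw => (Finset.mem_Ico.1 hw).1
  have hVW : Disjoint V W := by
    rw [Finset.disjoint_left]
    intro v hv hw
    have := hb v hv
    have := hbW v hw
    omega
  have hset : StageSetup f σ V W m y := {
    isInstance := hσ
    eq_of_mem := hin
    fresh := fun g hg w hw hwg => by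
      have := hB g hg w hwg
      have := hbW w hw
      omega
    disjoint := hVW
    pos := hy
    kill := hkill
    sum_nonneg := hm }
  have hWn : W.card = n := by simp [hW]
  have hn0 : (0 : ℝ) ≤ n := Nat.cast_nonneg _
  obtain ⟨P, hP, hD⟩ := hset.exists_pairList hV hWn hacc hd0 (min_le_left _ _) hdV (by omega)
    (hn₁.trans (by exact_mod_cast (by omega : n₁ ≤ n)))
  have hdevle : ∀ S : Finset ℕ, (∀ M, StageMatching V W y M →
      ((deviating {y} S M).card : ℝ) ≤ n - touchCount W M) →
      expect f ∅ (σ ++ pairEdges P y) (fun M => (deviating {y} S M).card) ≤ ε * n := by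
    intro S hS
    refine (expect_mono fun M hM => hS M (hset.stageMatching hP hM)).trans (hD.trans ?_)
    gcongr
    linarith
  refine ⟨n, by omega, σ ++ pairEdges P y, V, W, N, hset.isInstance_append hP, hV, hWn, hVW,
    ?_, ?_, hdevle V ?_, hdevle W ?_, fun g hg => List.mem_append_left _ (hNσ g hg), hN, hNV, ?_, hr⟩
  · intro g hg w hw w' hw' hwg hwg'
    rcases List.mem_append.1 hg with hg | hg
    · exact absurd hwg (hset.fresh g hg w hw)
    · obtain ⟨q, hq, rfl⟩ := List.mem_map.1 hg
      have hq2 := (Finset.mem_product.1 (hP.2 q hq)).1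
      have key : ∀ t ∈ W, t ∈ (mkEdge q.1 q.2 y).ends → t = q.2 := by
        intro t ht ht'
        rcases mem_ends_mkEdge.1 ht' with rfl | rfl
        · exact absurd ht (Finset.disjoint_left.1 hVW hq2)
        · rfl
      rw [key w hw hwg, key w' hw' hwg']
  -- Old weight in excess of `m.sum` per untouched vertex cannot grow, and it is small at the start.
  -- As few untouched vertices remain, nearly all old weight is gone and about `y * n` is left.
  · have h1 := hset.expect_le
      (F := fun M => -(oldWeight W M - m.sum * (untouched m V W M).card))
      (fun M hM v hv w hw hends hacc' =>
        neg_le_neg (hM.step hVW hkill hm hv hw hends hacc').2.2) hP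
    have h2 : expect f ∅ σ (fun M => -(m.sum * e * n) + (m.sum * n - totalWeight M) +
        m.sum * (e * n - (deviating m V M).card)) ≤
        expect f ∅ σ (fun M => -(oldWeight W M - m.sum * (untouched m V W M).card)) := by
      refine expect_mono fun M hM => ?_
      have h3 : oldWeight W M ≤ totalWeight M :=
        Finset.sum_le_sum_of_subset_of_nonneg (Finset.filter_subset _ _)
          fun g hg _ => (hσ.1 g (hM.mem hg)).2.le
      rw [hset.untouched_card hM, hV]
      linarith
    have h4 : expect f ∅ (σ ++ pairEdges P y) totalWeight ≤
        expect f ∅ (σ ++ pairEdges P y) (fun M => y * n +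
          m.sum * ((n : ℝ) - touchCount W M) -
          -(oldWeight W M - m.sum * (untouched m V W M).card)) := by
      refine expect_mono fun M hM => ?_
      have hS := hset.stageMatching hP hM
      have h5 : totalWeight M = y * touchCount W M + oldWeight W M := by
        unfold oldWeight totalWeight touchCount
        rw [← Finset.sum_filter_add_sum_filter_not M (Touches W)]
        congr 1
        rw [Finset.sum_congr rfl (g := fun _ => y)]
        · rw [Finset.sum_const, nsmul_eq_mul, mul_comm]
        · intro g hg
          obtain ⟨v, _, w, _, rfl⟩ := hS.new g (Finset.mem_filter.1 hg).1 (Finset.mem_filter.1 hg).2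
          rfl
      have h6 : ((untouched m V W M).card : ℝ) + touchCount W M ≤ n := by
        rw [← hV]
        exact_mod_cast hS.card_untouched_add_le
      have h7 : (0 : ℝ) ≤ (untouched m V W M).card := Nat.cast_nonneg _
      have h8 := mul_le_mul_of_nonneg_left h6 hm
      have h9 : y * (touchCount W M : ℝ) ≤ y * n :=
        mul_le_mul_of_nonneg_left (by linarith) hy.le
      rw [h5]
      linarith
    rw [expect_sub, expect_add, expect_const, expect_const_mul] at h4
    rw [expect_add, expect_add, expect_const, expect_sub, expect_const, expect_const_mul, expect_sub,
      expect_const] at h2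
    have h10 := mul_le_mul_of_nonneg_left hD hm
    have h11 := mul_nonneg hm (sub_nonneg.2 hdV)
    rw [Multiset.sum_singleton]
    have h12 : (e + m.sum * e + m.sum * d) * n ≤ ε * n := by
      refine mul_le_mul_of_nonneg_right ?_ hn0
      have := mul_le_mul_of_nonneg_left hed hm
      nlinarith
    linarith
  -- A vertex covered by a new edge sees exactly `{y}`, so only uncovered vertices deviate.
  · intro M hM
    rw [← hM.card_left, ← hV, deviating, le_sub_iff_add_le,
      ← Finset.card_filter_add_card_filter_not (s := V) fun v => weightsAt M v ≠ {y}]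
    push_cast
    refine add_le_add_right ?_ _
    norm_cast
    refine Finset.card_le_card fun v hv => ?_
    rw [Finset.mem_filter] at hv ⊢
    refine ⟨hv.1, ?_⟩
    rw [not_not]
    obtain ⟨_, g, hg, hgW, hvg⟩ := hv
    obtain ⟨v', _, w', _, rfl⟩ := hM.new g hg hgW
    exact hM.isMatching.weightsAt_eq hg hvg
  · intro M hM
    rw [← hM.card_right hVW, ← hWn, deviating, le_sub_iff_add_le,
      ← Finset.card_filter_add_card_filter_not (s := W) fun v => weightsAt M v ≠ {y}]
    push_cast
    refine add_le_add_right ?_ _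
    norm_cast
    refine Finset.card_le_card fun w hw => ?_
    rw [Finset.mem_filter] at hw ⊢
    refine ⟨hw.1, ?_⟩
    rw [not_not]
    obtain ⟨hw, g, hg, hwg⟩ := hw
    obtain ⟨v', _, w', _, rfl⟩ := hM.new g hg ⟨w, hw, hwg⟩
    exact hM.isMatching.weightsAt_eq hg hwg
  · intro g hg w hw
    exact hset.fresh g (hNσ g hg) w hw

end Induction

/-! ### The recursion for the ratio and the constant `3 + 2 * √2` -/

section Ratio

variable {f : Multiset ℝ → ℝ → unitInterval} {c : ℝ}

/-- `Z` consists of the weights rejected against `x`. Taking `z` in `Z` near its supremum and `y`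
just above it needs no monotonicity of `f`. The bound `r + 2 * z ≤ c * x` comes from pendants at
both sides. -/
theorem Prepared.extend (hf : LocalCompetitive f c) {x r t : ℝ} (hx : 0 < x) (ht0 : 0 < t)
    (ht1 : t < 1) (h : Prepared f {x} r) :
    ∃ y z : ℝ, 0 < y ∧ t * y ≤ z ∧ r + 2 * z ≤ c * x ∧ Prepared f {y} (r + z) := by
  let Z : Set ℝ := {z | 0 < z ∧ (f {x} z : ℝ) = 0}
  have hup : ∀ z ∈ Z, r + 2 * z ≤ c * x := by
    intro z hz
    have := hf.add_le (h.pendant hz.1 hz.2) hz.1 hz.2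
    rw [Multiset.sum_singleton] at this
    linarith
  have hbdd : BddAbove Z := ⟨(c * x - r) / 2, fun z hz => by linarith [hup z hz]⟩
  have hc := hf.1
  -- Any positive weight below `x / c` is rejected, by `le_of_accept`.
  have hmem : x / (2 * c) ∈ Z := by
    refine ⟨by positivity, ?_⟩
    by_contra hne
    have h1 := hf.le_of_accept hx (by positivity : 0 < x / (2 * c))
      (lt_of_le_of_ne (f {x} (x / (2 * c))).2.1 (Ne.symm hne))
    have h2 : c * (x / (2 * c)) = x / 2 := by field_simp
    linarith
  set s := sSup Z with hs
  have hs0 : 0 < s := hmem.1.trans_le (le_csSup hbdd hmem)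
  -- The midpoint of `s` and `s / t`, so that `t * y < s < y`.
  set y := s * (1 + 1 / t) / 2 with hy
  have hty : t * y = s * (t + 1) / 2 := by rw [hy]; field_simp
  have hsy : s < y := by
    have : 1 < 1 / t := by rwa [lt_div_iff₀ ht0, one_mul]
    rw [hy]
    nlinarith
  have hy0 : 0 < y := hs0.trans hsy
  obtain ⟨z, hz, hyz⟩ := exists_lt_of_lt_csSup ⟨_, hmem⟩ (show t * y < sSup Z by
    rw [hty, ← hs]; nlinarith)
  refine ⟨y, z, hy0, hyz.le, hup z hz, ?_⟩
  refine (h.pendant hz.1 hz.2).stage (by simpa using hx.le) hy0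
    (fun a ha => hf.accept_pair_eq_zero ha hy0) ?_
  refine lt_of_le_of_ne (f {x} y).2.1 fun h0 => ?_
  exact absurd (le_csSup hbdd (show y ∈ Z from ⟨hy0, h0.symm⟩)) (not_le.2 hsy)

/-- This says `ρ / v + 1 ≥ ρ + k`. Inserting `v ≤ (d - ρ) / 2` leaves a quadratic in `ρ`; completing
the square at `(d - 1) / 2` shows that it is nonnegative. -/
theorem ratio_step {d ρ v k : ℝ} (hρ : 0 ≤ ρ) (hv : 0 < v) (hd : 2 * v ≤ d - ρ) (hk : 0 ≤ k)
    (hkd : k * d ≤ d - (d - 1) ^ 2 / 4) : (ρ + k - 1) * v ≤ ρ := by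
  rcases le_or_gt (ρ + k - 1) 0 with h | h
  · exact (mul_nonpos_of_nonpos_of_nonneg h hv.le).trans hρ
  · have h1 := mul_le_mul_of_nonneg_left hd h.le
    nlinarith [sq_nonneg (ρ - (d - 1) / 2), mul_nonneg hk hρ]

theorem LocalCompetitive.le_ratio (hf : LocalCompetitive f c) : 3 + 2 * Real.sqrt 2 ≤ c := by
  by_contra hlt
  push Not at hlt
  have hc := hf.1
  have hsq : Real.sqrt 2 ^ 2 = 2 := Real.sq_sqrt (by norm_num)
  have hs1 : 1 ≤ Real.sqrt 2 := by
    rw [Real.one_le_sqrt]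
    norm_num
  -- Room between `c` and the threshold: `t = c / d < 1` absorbs the gap between `z` and `y`, and
  -- `d` is still below `3 + 2 * √2`.
  set d := (c + (3 + 2 * Real.sqrt 2)) / 2 with hd
  have hd0 : 0 < d := by positivity
  have hcd : c < d := by linarith
  -- Four times this quantity is `8 - (d - 3) ^ 2`, positive exactly for `d` strictly between `3 - 2
  -- * √2` and `3 + 2 * √2`.
  have hdlt : 0 < d - (d - 1) ^ 2 / 4 := by
    have h1 : 0 < 2 * Real.sqrt 2 - (d - 3) := by linarith
    have h2 : 0 < 2 * Real.sqrt 2 + (d - 3) := by linarith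
    nlinarith [mul_pos h1 h2]
  set k := (d - (d - 1) ^ 2 / 4) / d with hk
  have hk0 : 0 < k := div_pos hdlt hd0
  have hkd : k * d = d - (d - 1) ^ 2 / 4 := div_mul_cancel₀ _ hd0.ne'
  set t := c / d with ht
  have ht0 : 0 < t := div_pos hc hd0
  have ht1 : t < 1 := (div_lt_one hd0).2 hcd
  have htd : t * d = c := div_mul_cancel₀ _ hd0.ne'
  have key : ∀ j : ℕ, ∃ x r : ℝ, 0 < x ∧ 0 ≤ r ∧ Prepared f {x} r ∧ j * k * (t * x) ≤ r := by
    intro j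
    induction j with
    | zero =>
      refine ⟨1, 0, one_pos, le_rfl, ?_, by simp⟩
      -- The start is a stage on isolated vertices, which see no weights, with edges of weight `1`.
      exact (halfPrepared_zero f).stage (by simp) one_pos
        (fun a ha => hf.accept_pair_eq_zero ha one_pos) (hf.accept_free_pos one_pos)
    | succ j ih =>
      obtain ⟨x, r, hx, hr, hP, hjr⟩ := ih
      obtain ⟨y, z, hy, htyz, hrz, hP'⟩ := hP.extend hf hx ht0 ht1
      have htx : 0 < t * x := mul_pos ht0 hx
      have hz0 : 0 < z := (mul_pos ht0 hy).trans_le htyz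
      refine ⟨y, r + z, hy, by linarith, hP', ?_⟩
      set ρ := r / (t * x) with hρ
      have hρr : ρ * (t * x) = r := div_mul_cancel₀ _ htx.ne'
      have hρ0 : 0 ≤ ρ := div_nonneg hr htx.le
      have hjρ : j * k ≤ ρ := (le_div_iff₀ htx).2 hjr
      have hv : 2 * (y / x) ≤ d - ρ := by
        have h1 : 2 * (t * y) ≤ (d - ρ) * (t * x) := by
          calc 2 * (t * y) ≤ c * x - r := by linarith
            _ = (d - ρ) * (t * x) := by rw [sub_mul, hρr, ← htd]; ring
        have h2 : 2 * y ≤ (d - ρ) * x := by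
          refine le_of_mul_le_mul_left ?_ ht0
          linarith
        rw [← mul_div_assoc, div_le_iff₀ hx]
        exact h2
      have h3 := ratio_step hρ0 (div_pos hy hx) hv hk0.le hkd.le
      have h4 := mul_le_mul_of_nonneg_right h3 htx.le
      have h5 : (ρ + k - 1) * (y / x) * (t * x) = (ρ + k - 1) * (t * y) := by field_simp
      rw [h5, hρr] at h4
      have h6 := mul_le_mul_of_nonneg_right hjρ (mul_pos ht0 hy).le
      push_cast
      linarith
  -- After more than `d / k` rounds, `r` exceeds `d * (t * x) = c * x`, against `r + 2 * z ≤ c * x`.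
  obtain ⟨j, hj⟩ := exists_nat_gt (d / k)
  rw [div_lt_iff₀ hk0] at hj
  obtain ⟨x, r, hx, hr, hP, hjr⟩ := key j
  obtain ⟨y, z, hy, htyz, hrz, _⟩ := hP.extend hf hx ht0 ht1
  have hz0 : 0 < z := (mul_pos ht0 hy).trans_le htyz
  have h1 := mul_lt_mul_of_pos_right hj (mul_pos ht0 hx)
  have h2 : d * (t * x) = c * x := by rw [← htd]; ring
  linarith

end Ratio

end

theorem mainTheorem2 (A : OnlineAlgorithm) (hA : A.IsLocal) (c : ℝ) (hc : A.IsCompetitive c) :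
    3 + 2 * Real.sqrt 2 ≤ c := by
  obtain ⟨f, hf⟩ := exists_localCompetitive hA hc
  exact hf.le_ratio
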